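/- Let $\psi=\Gamma'/\Gamma$ be the digamma function and, for $a>0$ and integers $u\ge 2$, let $\zeta(u,a)=\sum_{k\ge 0}(k+a)^{-u}$ be the Hurwitz zeta function. There is a number $z_m>0$ which is the unique point at which $\Gamma$ attains its minimum on $(0,\infty)$ and the unique zero of $\psi$ in $(0,\infty)$, and the following holds for every $a>0$. The functions $\psi$ and $$\mathcal L(z)=\frac{z-a}{\psi(z)-\psi(a)}\quad(z\ne a),\qquad \mathcal L(a)=\frac1{\psi'(a)},$$ are analytic at $a$; one has $\psi^{(j)}(a)=(-1)^{j+1}\,j!\,\zeta(j+1,a)$ for all $j\ge1$; and for all $n\ge 1$, $\ell\ge0$, $$\left.\frac{d^{n-1}}{dz^{n-1}}\mathcal L(z)^n\right|_{z=a}=\sum_{\ell_1+\cdots+\ell_n=n-1}\binom{n-1}{\ell_1,\dots,\ell_n}\prod_{i=1}^n\mathcal L^{(\ell_i)}(a),$$ $$\mathcal L^{(\ell)}(a)=\frac{\ell!}{\psi'(a)^{\ell+1}}\sum_{k}\frac{(-1)^{\ell-k_0}(\ell-k_0)!}{\prod_{j=1}^{\ell}(j!)^{k_j}\,k_j!}\prod_{j=0}^{\ell}\left[\frac{\psi^{(j+1)}(a)}{j+1}\right]^{k_j},\qquad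 \frac{\psi^{(j+1)}(a)}{j+1}=(-1)^j\,j!\,\zeta(j+2,a),$$ where the sum is over all nonnegative integers $k_0,\dots,k_\ell$ with $\ell=k_0+k_1+\cdots+k_\ell=k_1+2k_2+\cdots+\ell k_\ell$ (so that $k_0=k_2+2k_3+\cdots+(\ell-1)k_\ell$). Consequently the Lagrange series of $\psi$ about $a$ takes the three termwise equal forms $$a+\sum_{n=1}^\infty\frac{[-\psi(a)]^n}{n!}\left.\frac{d^{n-1}}{dz^{n-1}}\mathcal L(z)^n\right|_{z=a}$$ $$=a+\sum_{n=1}^\infty\frac{[-\psi(a)]^n}{n!}\sum_{\ell_1+\cdots+\ell_n=n-1}\binom{n-1}{\ell_1,\dots,\ell_n}\prod_{i=1}^n\frac{\ell_i!}{\psi'(a)^{\ell_i+1}}\sum_{k}\frac{(-1)^{\ell_i-k_0}(\ell_i-k_0)!}{\prod_{j=1}^{\ell_i}(j!)^{k_j}\,k_j!}\prod_{j=0}^{\ell_i}\left[\frac{\psi^{(j+1)}(a)}{j+1}\right]^{k_j}$$ $$=a+\sum_{n=1}^\infty\frac{[-\psi(a)]^n}{n!}\sum_{\ell_1+\cdots+\ell_n=n-1}\binom{n-1}{\ell_1,\dots,\ell_n}\prod_{i=1}^n\frac{\ell_i!}{\zeta(2,a)^{\ell_i+1}}\sum_{k}\frac{(-1)^{\ell_i-k_0}(\ell_i-k_0)!}{\prod_{j=1}^{\ell_i}(j!)^{k_j}\,k_j!}\prod_{j=0}^{\ell_i}\bigl[(-1)^{j}\,j!\,\zeta(j+2,a)\bigr]^{k_j}.$$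 For $\frac12\le a\le\frac52$ (in particular for $a=1$ and $a=\frac32$) the series converges absolutely and its value is $z_m$. For every $a>0$ for which the series converges, even only conditionally, its value is $z_m$. -/

import Mathlib

open Filter Topology

noncomputable section

namespace GammaMin

/-- The digamma function `ψ = Γ' / Γ` of a real variable. -/
def psi (z : ℝ) : ℝ := deriv Real.Gamma z / Real.Gamma z

/-- The Hurwitz zeta function `ζ(u, v) = ∑_{k ≥ 0} 1 / (k + v) ^ u` at an integer `u`
(used only for `u ≥ 2` and `v > 0`, where the series converges). -/
def hurwitz (u : ℕ) (v : ℝ) : ℝ := ∑' k : ℕ, 1 / ((k : ℝ) + v) ^ u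

/-- `𝓛(z) = (z - a) / (ψ(z) - ψ(a))`, with its removable singularity at `z = a` removed
by the value `1 / ψ'(a)`. -/
def lagrangeL (a : ℝ) : ℝ → ℝ :=
  Function.update (fun z => (z - a) / (psi z - psi a)) a (1 / deriv psi a)

/-- The Lagrange coefficient for the index `n + 1`, that is
`d^n / dz^n [𝓛(z)] ^ (n + 1)` at `z = a`. -/
def lagrangeCoeff (a : ℝ) (n : ℕ) : ℝ :=
  iteratedDeriv n (fun z => lagrangeL a z ^ (n + 1)) a

/-- The tuples `(k_0, …, k_l)` of nonnegative integers with
`l = k_0 + k_1 + ⋯ + k_l = k_1 + 2 k_2 + ⋯ + l k_l`.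
Subtracting the two relations gives `k_0 = k_2 + 2 k_3 + ⋯ + (l - 1) k_l`. -/
def faaDiBrunoIndex (l : ℕ) : Finset (Fin (l + 1) → ℕ) :=
  (Finset.piAntidiag Finset.univ l).filter (fun k => ∑ j : Fin (l + 1), (j : ℕ) * k j = l)

/-- Faà di Bruno's formula for the `l`-th derivative of a reciprocal `1 / g`, written in terms of
the values `c j = g^(j)(a)` for `j = 0, …, l`:
`l! / (c 0)^(l+1) * ∑_k (-1)^(l - k_0) (l - k_0)! / (∏_{j=1}^l (j!)^(k_j) k_j!) * ∏_{j=0}^l (c j)^(k_j)`. -/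
def reciprocalDeriv (c : ℕ → ℝ) (l : ℕ) : ℝ :=
  (l.factorial : ℝ) / c 0 ^ (l + 1) *
    ∑ k ∈ faaDiBrunoIndex l,
      ((-1 : ℝ) ^ (l - k 0) * ((l - k 0).factorial : ℝ)) /
          (∏ j : Fin l, ((((j : ℕ) + 1).factorial : ℝ) ^ k j.succ * ((k j.succ).factorial : ℝ))) *
        ∏ j : Fin (l + 1), c j ^ k j

/-- The twofold Faà di Bruno expression for the index `n + 1`:
the sum over all `(l_1, …, l_{n+1})` with `l_1 + ⋯ + l_{n+1} = n` of the multinomial coefficient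
`n! / (l_1! ⋯ l_{n+1}!)` times `∏_i reciprocalDeriv c l_i`. -/
def doubleFaaDiBruno (c : ℕ → ℝ) (n : ℕ) : ℝ :=
  ∑ l ∈ Finset.piAntidiag (Finset.univ : Finset (Fin (n + 1))) n,
    (Nat.multinomial Finset.univ l : ℝ) * ∏ i, reciprocalDeriv c (l i)

/-- The derivatives at `a` of `(ψ(z) - ψ(a)) / (z - a)`, that is `ψ^(j+1)(a) / (j + 1)`. -/
def psiData (a : ℝ) (j : ℕ) : ℝ := iteratedDeriv (j + 1) psi a / ((j : ℝ) + 1)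

/-- The same numbers written with Hurwitz zeta values: `(-1)^j j! ζ(j + 2, a)`. -/
def zetaData (a : ℝ) (j : ℕ) : ℝ := (-1 : ℝ) ^ j * (j.factorial : ℝ) * hurwitz (j + 2) a

/-- The term of index `n + 1` of the Lagrange series, `[-ψ(a)]^(n+1) / (n+1)! * C n`. -/
def seriesTerm (a : ℝ) (C : ℕ → ℝ) (n : ℕ) : ℝ :=
  (-psi a) ^ (n + 1) / ((n + 1).factorial : ℝ) * C n

end GammaMin

end

/-! The Lagrange series is the Taylor series at `ψ(a)` of an inverse of `ψ`, evaluated at `0`. Its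
value is therefore the zero of `ψ`, and since `Γ' = Γ ψ` with `ψ` strictly increasing, that zero is
the minimum point of `Γ`. Lagrange inversion (`iteratedDeriv_leftInverse`) and the Faà di Bruno
expansion of a reciprocal are proved as identities of formal power series. The substance is to show
how far the inverse extends.

Univalence on `Re z > 0`: the difference quotient of `ψ` is `∑ 1 / ((k + z)(k + w))`. Since `Im
ψ(z)` has the sign of `Im z`, equal values force `Im z` and `Im w` not to have opposite signs; then
all the denominators lie in one open half-plane and the sum cannot vanish (`injOn_digammaC`).

Size of the image: `ψ` blows up at `0` and at `∞` in the closed half-plane, so boundary points of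
the image are values on the imaginary axis, where `Re ψ ≥ -γ` and `|Im ψ| ≥ π / 2`. A disc about
`ψ(a)` avoiding this region lies in the image (`subset_image_digammaC`), and the Taylor series of
the inverse converges on it. For `1/2 ≤ a ≤ 5/2` such a disc contains `0`.

For other `a` the inverse is still real analytic on all of `ℝ`, so Abel's theorem identifies the sum
whenever the series converges (`eq_of_tendsto_seriesTerm`). -/

namespace GammaMin

/-! ### Taylor coefficients as formal power series -/

section FormalSeries

open PowerSeries

/-- The Taylor series of `f` at `a`, as a formal power series in `z - a`. -/
noncomputable def taylorSeries (f : ℝ → ℝ) (a : ℝ) : PowerSeries ℝ :=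
  PowerSeries.mk fun n => iteratedDeriv n f a / n.factorial

lemma coeff_taylorSeries (f : ℝ → ℝ) (a : ℝ) (n : ℕ) :
    coeff n (taylorSeries f a) = iteratedDeriv n f a / n.factorial := by
  simp [taylorSeries]

lemma iteratedDeriv_eq_coeff_taylorSeries (f : ℝ → ℝ) (a : ℝ) (n : ℕ) :
    iteratedDeriv n f a = n.factorial * coeff n (taylorSeries f a) := by
  rw [coeff_taylorSeries]
  field_simp

lemma taylorSeries_congr {f g : ℝ → ℝ} {a : ℝ} (h : f =ᶠ[𝓝 a] g) :
    taylorSeries f a = taylorSeries g a := by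
  ext n
  simp only [coeff_taylorSeries, h.iteratedDeriv_eq n]

lemma taylorSeries_const (c a : ℝ) : taylorSeries (fun _ => c) a = C c := by
  ext n
  rw [coeff_taylorSeries, iteratedDeriv_const, coeff_C]
  split_ifs with h <;> simp [h]

lemma taylorSeries_add {f g : ℝ → ℝ} {a : ℝ} (hf : AnalyticAt ℝ f a) (hg : AnalyticAt ℝ g a) :
    taylorSeries (fun z => f z + g z) a = taylorSeries f a + taylorSeries g a := by
  ext n
  have := iteratedDeriv_add (n := n) hf.contDiffAt hg.contDiffAt
  simp only [coeff_taylorSeries, map_add, ← add_div, ← this]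
  rfl

lemma taylorSeries_mul {f g : ℝ → ℝ} {a : ℝ} (hf : AnalyticAt ℝ f a) (hg : AnalyticAt ℝ g a) :
    taylorSeries (fun z => f z * g z) a = taylorSeries f a * taylorSeries g a := by
  ext n
  have := iteratedDeriv_mul (n := n) hf.contDiffAt hg.contDiffAt
  rw [coeff_mul, Finset.Nat.sum_antidiagonal_eq_sum_range_succ
    (fun i j => coeff i (taylorSeries f a) * coeff j (taylorSeries g a)), coeff_taylorSeries]
  change iteratedDeriv n (f * g) a / _ = _
  rw [this, Finset.sum_div]
  refine Finset.sum_congr rfl fun i hi => ?_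
  have hi' : i ≤ n := by simpa [Nat.lt_succ_iff] using hi
  rw [coeff_taylorSeries, coeff_taylorSeries, Nat.cast_choose ℝ hi']
  field_simp

lemma taylorSeries_pow {f : ℝ → ℝ} {a : ℝ} (hf : AnalyticAt ℝ f a) (n : ℕ) :
    taylorSeries (fun z => f z ^ n) a = taylorSeries f a ^ n := by
  induction n with
  | zero => simpa using taylorSeries_const 1 a
  | succ n ih => simp only [pow_succ, ← ih, ← taylorSeries_mul (hf.fun_pow n) hf]

lemma taylorSeries_const_mul {f : ℝ → ℝ} {a : ℝ} (hf : AnalyticAt ℝ f a) (c : ℝ) :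
    taylorSeries (fun z => c * f z) a = C c * taylorSeries f a := by
  rw [taylorSeries_mul analyticAt_const hf, taylorSeries_const]

lemma taylorSeries_sum {ι : Type*} (s : Finset ι) {f : ι → ℝ → ℝ} {a : ℝ}
    (hf : ∀ i ∈ s, AnalyticAt ℝ (f i) a) :
    taylorSeries (fun z => ∑ i ∈ s, f i z) a = ∑ i ∈ s, taylorSeries (f i) a := by
  classical
  induction s using Finset.induction_on with
  | empty => simpa using taylorSeries_const 0 a
  | insert i s hi ih =>
    simp only [Finset.mem_insert, forall_eq_or_imp] at hf
    simp only [Finset.sum_insert hi, ← ih hf.2]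
    exact taylorSeries_add hf.1 (Finset.analyticAt_fun_sum _ hf.2)

lemma taylorSeries_sub_const (a : ℝ) : taylorSeries (fun z => z - a) a = X := by
  ext n
  rw [coeff_taylorSeries, coeff_X]
  rcases n with _ | _ | n
  · simp
  · simp [iteratedDeriv_one]
  · have h1 : deriv (fun z : ℝ => z - a) = fun _ => 1 := by ext; simp
    rw [iteratedDeriv_succ', h1, iteratedDeriv_const]
    simp

lemma analyticAt_dslope {f : ℝ → ℝ} {a : ℝ} (hf : AnalyticAt ℝ f a) :
    AnalyticAt ℝ (dslope f a) a := by
  obtain ⟨p, hp⟩ := hf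
  exact ⟨_, hp.has_fpower_series_dslope_fslope⟩

lemma taylorSeries_sub_eq_X_mul {f : ℝ → ℝ} {a : ℝ} (hf : AnalyticAt ℝ f a) :
    taylorSeries (fun z => f z - f a) a = X * taylorSeries (dslope f a) a := by
  rw [← taylorSeries_sub_const, ← taylorSeries_mul (by fun_prop) (analyticAt_dslope hf)]
  congr 1
  ext z
  simpa using (sub_smul_dslope f a z).symm

lemma iteratedDeriv_dslope {f : ℝ → ℝ} {a : ℝ} (hf : AnalyticAt ℝ f a) (n : ℕ) :
    iteratedDeriv n (dslope f a) a = iteratedDeriv (n + 1) f a / (n + 1) := by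
  have h := congrArg (coeff (n + 1)) (taylorSeries_sub_eq_X_mul hf)
  rw [coeff_succ_X_mul, coeff_taylorSeries, coeff_taylorSeries, iteratedDeriv_succ'] at h
  have h1 : deriv (fun z => f z - f a) = deriv f := by ext; simp
  rw [h1, ← iteratedDeriv_succ', Nat.factorial_succ, Nat.cast_mul, Nat.cast_succ] at h
  have : (n.factorial : ℝ) ≠ 0 := by positivity
  field_simp at h ⊢
  linarith

/-! ### Lagrange inversion -/

/-- If `φ d = 1` then the derivative of `X d` has "residue" one against `(X d)⁻¹` and residue zero
against every other negative power of `X d`. -/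
lemma coeff_pow_mul_derivative_X_mul {φ d : PowerSeries ℝ} (h : φ * d = 1) (m : ℕ) :
    coeff m (φ ^ (m + 1) * derivative ℝ (X * d)) = if m = 0 then 1 else 0 := by
  have e1 : φ ^ (m + 1) * derivative ℝ (X * d)
      = φ ^ m + X * (φ ^ (m + 1) * derivative ℝ d) := by
    rw [Derivation.leibniz, derivative_X]
    simp only [smul_eq_mul, mul_one]
    linear_combination φ ^ m * h
  have hD : derivative ℝ φ * d = - (φ * derivative ℝ d) := by
    have := congrArg (derivative ℝ) h
    rw [Derivation.leibniz, derivative_one] at this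
    simp only [smul_eq_mul] at this
    linear_combination this
  have hφ : derivative ℝ φ = - (φ ^ 2 * derivative ℝ d) := by
    linear_combination φ * hD - derivative ℝ φ * h
  rcases m with _ | m
  · have := congrArg (coeff 0) h
    rw [e1]
    simp
  -- With exponent `m + 1`, the two contributions in `e1` cancel: `(φ ^ (m + 1))' = -(m + 1) φ ^ (m
  -- + 2) d'`, compared at index `m`, says that `m + 1` times their sum is zero.
  · have e2 : derivative ℝ (φ ^ (m + 1))
        = - (C ((m : ℝ) + 1) * (φ ^ (m + 2) * derivative ℝ d)) := by
      rw [derivative_pow, hφ]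
      simp
      ring
    have e3 := congrArg (coeff m) e2
    rw [coeff_derivative, map_neg, coeff_C_mul] at e3
    rw [e1, map_add, coeff_succ_X_mul, if_neg (by omega)]
    have : (m : ℝ) + 1 ≠ 0 := by positivity
    have e4 : ((m : ℝ) + 1) * (coeff (m + 1) (φ ^ (m + 1))
      + coeff m (φ ^ (m + 1 + 1) * derivative ℝ d)) = 0 := by
      linear_combination e3
    exact (mul_eq_zero.mp e4).resolve_left this

/-- **Lagrange inversion** for formal power series: if `X = ∑ₖ gₖ hᵏ` for `h = X d` and `φ = 1 / d`,
then `(n + 1) gₙ₊₁` is the coefficient of index `n` of `φ ^ (n + 1)`. -/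
lemma lagrange_inversion {φ d r : PowerSeries ℝ} (h : φ * d = 1) (n : ℕ) (g : ℕ → ℝ)
    (hg : X = ∑ k ∈ Finset.range (n + 1), C (g (k + 1)) * (X * d) ^ (k + 1) + X ^ (n + 2) * r) :
    (n + 1) * g (n + 1) = coeff n (φ ^ (n + 1)) := by
  -- Differentiate, multiply by `φ ^ (n + 1)` and read off index `n`. As `φ d = 1`, the `k`-th term
  -- becomes `X ^ k` times the residue expression of order `n - k`, so only `k = n` survives; the
  -- remainder keeps a factor `X ^ (n + 1)`.
  have h1 := congrArg (derivative ℝ) hg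
  have h2 : φ ^ (n + 1) = ∑ k ∈ Finset.range (n + 1),
      C (((k : ℝ) + 1) * g (k + 1)) * (X ^ k * (φ ^ (n - k + 1) * derivative ℝ (X * d)))
      + X ^ (n + 1) * (φ ^ (n + 1) * (C ((n : ℝ) + 2) * r + X * derivative ℝ r)) := by
    rw [derivative_X, map_add, map_sum] at h1
    have h3 := congrArg (φ ^ (n + 1) * ·) h1
    simp only [mul_one, mul_add, Finset.mul_sum] at h3
    refine h3.trans ?_
    congr 1
    · refine Finset.sum_congr rfl fun k hk => ?_
      have hk' : k ≤ n := by simpa [Nat.lt_succ_iff] using hk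
      have e : φ ^ (n + 1) * d ^ k = φ ^ (n - k + 1) := by
        have : n + 1 = (n - k + 1) + k := by omega
        rw [this, pow_add, mul_assoc, ← mul_pow, h, one_pow, mul_one]
      rw [Derivation.leibniz, derivative_C, derivative_pow]
      simp only [smul_eq_mul, mul_zero, add_zero, Nat.add_sub_cancel, map_mul, map_add, map_natCast,
        map_one, Nat.cast_add, Nat.cast_one, mul_pow, ← e]
      ring
    · rw [Derivation.leibniz, derivative_pow, derivative_X]
      simp only [smul_eq_mul, map_add, map_natCast, Nat.cast_add, map_ofNat, Nat.cast_ofNat,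
        show n + 2 - 1 = n + 1 by omega]
      ring
  rw [h2, map_add, map_sum, coeff_X_pow_mul', if_neg (by omega), add_zero]
  rw [Finset.sum_eq_single_of_mem n (by simp)]
  · rw [coeff_C_mul, coeff_X_pow_mul', if_pos le_rfl, Nat.sub_self,
      coeff_pow_mul_derivative_X_mul h]
    simp
  · intro k hk hkn
    have hk' : k ≤ n := by simpa [Nat.lt_succ_iff] using hk
    rw [coeff_C_mul, coeff_X_pow_mul', if_pos hk', coeff_pow_mul_derivative_X_mul h,
      if_neg (by omega), mul_zero]

/-- **Lagrange inversion** for the derivatives of an analytic local inverse `F` of `f`. -/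
theorem iteratedDeriv_leftInverse {f F : ℝ → ℝ} {a : ℝ} (hf : AnalyticAt ℝ f a)
    (hF : AnalyticAt ℝ F (f a)) (hd : deriv f a ≠ 0) (h : ∀ᶠ z in 𝓝 a, F (f z) = z) (n : ℕ) :
    iteratedDeriv (n + 1) F (f a) = iteratedDeriv n (fun z => (dslope f a z)⁻¹ ^ (n + 1)) a := by
  have hda := analyticAt_dslope hf
  have hd0 : dslope f a a ≠ 0 := by simpa using hd
  have hia : AnalyticAt ℝ (fun z => (dslope f a z)⁻¹) a := hda.fun_inv hd0
  have hφ : taylorSeries (fun z => (dslope f a z)⁻¹) a * taylorSeries (dslope f a) a = 1 := by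
    rw [← taylorSeries_mul hia hda, ← map_one (C (R := ℝ)), ← taylorSeries_const 1 a]
    refine taylorSeries_congr ?_
    filter_upwards [hda.continuousAt.eventually_ne hd0] with z hz
    exact inv_mul_cancel₀ hz
  have hF0 : AnalyticAt ℝ (fun w => F (f a + w)) 0 := by
    refine AnalyticAt.fun_comp (f := fun w => f a + w) (g := F) ?_ (by fun_prop)
    simpa using hF
  -- A Taylor polynomial with analytic remainder suffices: composing it with `f` involves only
  -- finite sums and products, never composition of formal series.
  obtain ⟨Q, hQ, hQe⟩ := hF0.exists_eq_sum_add_pow_mul (n + 2)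
  set g : ℕ → ℝ := fun k => iteratedDeriv k F (f a) / k.factorial with hg
  have hfa : AnalyticAt ℝ (fun z => f z - f a) a := hf.fun_sub analyticAt_const
  have hQf : AnalyticAt ℝ (fun z => Q (f z - f a)) a :=
    AnalyticAt.fun_comp (f := fun z => f z - f a) (g := Q) (by simpa using hQ) hfa
  have hpt : (fun z => z - a) =ᶠ[𝓝 a] fun z =>
      (∑ k ∈ Finset.range (n + 1), g (k + 1) * (f z - f a) ^ (k + 1))
        + (f z - f a) ^ (n + 2) * Q (f z - f a) := by
    filter_upwards [h] with z hz
    have e := hQe (f z - f a)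
    rw [add_sub_cancel, hz, Finset.sum_range_succ'] at e
    have h0 : F (f a) = a := h.self_of_nhds
    simp only [iteratedDeriv_comp_const_add, smul_eq_mul, add_zero, pow_zero, Nat.factorial_zero,
      Nat.cast_one, div_one, one_mul, iteratedDeriv_zero, h0] at e
    have hsum : ∑ k ∈ Finset.range (n + 1), g (k + 1) * (f z - f a) ^ (k + 1)
        = ∑ k ∈ Finset.range (n + 1),
          (f z - f a) ^ (k + 1) / (k + 1).factorial * iteratedDeriv (k + 1) F (f a) :=
      Finset.sum_congr rfl fun k _ => by simp only [hg]; ring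
    rw [hsum]
    linear_combination e
  have hT := taylorSeries_congr hpt
  have hs : ∀ k ∈ Finset.range (n + 1),
      AnalyticAt ℝ (fun z => g (k + 1) * (f z - f a) ^ (k + 1)) a :=
    fun k _ => analyticAt_const.fun_mul (hfa.fun_pow _)
  rw [taylorSeries_sub_const, taylorSeries_add (Finset.analyticAt_fun_sum _ hs)
    ((hfa.fun_pow _).fun_mul hQf), taylorSeries_sum _ hs, taylorSeries_mul (hfa.fun_pow _) hQf,
    taylorSeries_pow hfa] at hT
  simp only [taylorSeries_const_mul (hfa.fun_pow _), taylorSeries_pow hfa,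
    taylorSeries_sub_eq_X_mul hf] at hT
  have key := lagrange_inversion hφ n g
    (r := taylorSeries (dslope f a) a ^ (n + 2) * taylorSeries (fun z => Q (f z - f a)) a)
    (by rw [← mul_assoc, ← mul_pow]; exact hT)
  rw [iteratedDeriv_eq_coeff_taylorSeries (fun z => (dslope f a z)⁻¹ ^ (n + 1)),
    taylorSeries_pow hia, ← key, hg]
  simp only [Nat.factorial_succ, Nat.cast_mul, Nat.cast_succ]
  have : (n.factorial : ℝ) ≠ 0 := by positivity
  field_simp

/-! ### Faà di Bruno's formula for reciprocals and powers -/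

lemma coeff_pow_sum_C_mul_X_pow {l : ℕ} (b : Fin l → ℝ) (m N : ℕ) :
    coeff N ((∑ j : Fin l, C (b j) * (X : PowerSeries ℝ) ^ ((j : ℕ) + 1)) ^ m)
      = ∑ k ∈ (Finset.piAntidiag (Finset.univ : Finset (Fin l)) m).filter
          (fun k => ∑ j : Fin l, ((j : ℕ) + 1) * k j = N),
          (Nat.multinomial Finset.univ k : ℝ) * ∏ j, b j ^ k j := by
  rw [Finset.sum_pow_eq_sum_piAntidiag, map_sum, Finset.sum_filter]
  refine Finset.sum_congr rfl fun k _ => ?_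
  have e : (Nat.multinomial Finset.univ k : PowerSeries ℝ)
      * ∏ j : Fin l, (C (b j) * (X : PowerSeries ℝ) ^ ((j : ℕ) + 1)) ^ k j
      = C ((Nat.multinomial Finset.univ k : ℝ) * ∏ j, b j ^ k j)
        * X ^ (∑ j : Fin l, ((j : ℕ) + 1) * k j) := by
    simp only [mul_pow, Finset.prod_mul_distrib, ← pow_mul, Finset.prod_pow_eq_pow_sum, map_mul,
      map_natCast, map_prod, map_pow]
    ring
  rw [e, coeff_C_mul, coeff_X_pow]
  split_ifs with h1 h2 h2
  · simp
  · exact absurd h1.symm h2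
  · exact absurd h2.symm h1
  · simp

/-- Modulo `X ^ (l + 1)`, `d` is `c - q` with `c` its constant term and `X ∣ q`. The finite
geometric sum `(c - q) ∑ q ^ i c ^ (l - i) = c ^ (l + 1) - q ^ (l + 1)` then inverts it, the last
power being negligible. The factor `c ^ (l + 1)` is kept on the left to avoid division. -/
lemma coeff_of_mul_eq_one {φ d : PowerSeries ℝ} (h : φ * d = 1) (l : ℕ) :
    (coeff 0 d) ^ (l + 1) * coeff l φ = ∑ m ∈ Finset.range (l + 1), (coeff 0 d) ^ (l - m) *
      coeff l ((∑ j : Fin l, C (-coeff ((j : ℕ) + 1) d) * (X : PowerSeries ℝ) ^ ((j : ℕ) + 1)) ^ m)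
      := by
  set q : PowerSeries ℝ := ∑ j : Fin l, C (-coeff ((j : ℕ) + 1) d) * X ^ ((j : ℕ) + 1) with hq
  have hr : X ^ (l + 1) ∣ d - (C (coeff 0 d) - q) := by
    rw [X_pow_dvd_iff]
    intro m hm
    rw [map_sub, map_sub, hq, map_sum]
    simp only [coeff_C_mul, coeff_X_pow]
    rcases m with _ | m
    · simp
    · rw [Finset.sum_eq_single (⟨m, by omega⟩ : Fin l)]
      · simp
      · rintro ⟨j, hj⟩ _ hne
        have : ¬ m = j := fun hh => hne (by simp [hh])
        simp [this]
      · simp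
  have hXq : X ∣ q := Finset.dvd_sum fun j _ => Dvd.intro_left _ (by rw [pow_succ, mul_assoc])
  obtain ⟨q', hq'⟩ := hXq
  obtain ⟨r, hr⟩ := hr
  have hgeom := geom_sum₂_mul q (C (coeff 0 d)) (l + 1)
  set S := ∑ i ∈ Finset.range (l + 1), q ^ i * C (coeff 0 d) ^ (l + 1 - 1 - i) with hS
  have hX : q ^ (l + 1) = X ^ (l + 1) * q' ^ (l + 1) := by rw [hq', mul_pow]
  have key : C (coeff 0 d ^ (l + 1)) * φ = S + X ^ (l + 1) * (φ * q' ^ (l + 1) - S * φ * r) := by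
    rw [map_pow]
    linear_combination S * h + φ * hgeom + φ * hX - S * φ * hr
  have := congrArg (coeff l) key
  rw [coeff_C_mul, map_add, coeff_X_pow_mul', if_neg (by omega), add_zero, hS, map_sum] at this
  rw [this]
  refine Finset.sum_congr rfl fun m _ => ?_
  rw [← map_pow, mul_comm, coeff_C_mul, Nat.add_sub_cancel]

/-- The entry `k_0` is determined by the others: if they add up to `m`, it is `l - m`. Grouping by
`m` matches the powers in the geometric sum. -/
lemma sum_faaDiBrunoIndex (l : ℕ) (T : (Fin (l + 1) → ℕ) → ℝ) :
    ∑ k ∈ faaDiBrunoIndex l, T k = ∑ m ∈ Finset.range (l + 1),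
      ∑ k ∈ (Finset.piAntidiag (Finset.univ : Finset (Fin l)) m).filter
          (fun k => ∑ j : Fin l, ((j : ℕ) + 1) * k j = l), T (Fin.cons (l - m) k) := by
  rw [Finset.sum_sigma']
  refine Finset.sum_bij' (fun k _ => ⟨l - k 0, Fin.tail k⟩) (fun p _ => Fin.cons (l - p.1) p.2)
    ?_ ?_ ?_ ?_ ?_
  · intro k hk
    simp only [faaDiBrunoIndex, Finset.mem_filter, Finset.mem_piAntidiag, Fin.sum_univ_succ] at hk
    simp only [Finset.mem_sigma, Finset.mem_range, Finset.mem_filter, Finset.mem_piAntidiag]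
    have ht : Finset.univ.sum (Fin.tail k) = ∑ i : Fin l, k i.succ := rfl
    exact ⟨by omega, ⟨by omega, by simp⟩, by simpa [Fin.tail] using hk.2⟩
  · rintro ⟨m, k⟩ hk
    simp only [Finset.mem_sigma, Finset.mem_range, Finset.mem_filter, Finset.mem_piAntidiag] at hk
    simp only [faaDiBrunoIndex, Finset.mem_filter, Finset.mem_piAntidiag, Fin.sum_univ_succ,
      Fin.cons_zero, Fin.cons_succ]
    have ht : ∑ i, k i = m := hk.2.1.1
    exact ⟨⟨by omega, by simp⟩, by simpa using hk.2.2⟩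
  · intro k hk
    simp only [faaDiBrunoIndex, Finset.mem_filter, Finset.mem_piAntidiag, Fin.sum_univ_succ] at hk
    have : l - (l - k 0) = k 0 := by omega
    simp only [this]
    exact Fin.cons_self_tail k
  · rintro ⟨m, k⟩ hk
    simp only [Finset.mem_sigma, Finset.mem_range] at hk
    have : l - (l - m) = m := by omega
    simp [this]
  · intro k hk
    simp only [faaDiBrunoIndex, Finset.mem_filter, Finset.mem_piAntidiag, Fin.sum_univ_succ] at hk
    have : l - (l - k 0) = k 0 := by omega
    simp only [this]
    rw [Fin.cons_self_tail k]

/-- **Faà di Bruno's formula** for a reciprocal, in terms of formal power series. -/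
lemma factorial_mul_coeff_eq_reciprocalDeriv {φ d : PowerSeries ℝ} (h : φ * d = 1) {c : ℕ → ℝ}
    (hc : ∀ j, coeff j d = c j / j.factorial) (l : ℕ) :
    l.factorial * coeff l φ = reciprocalDeriv c l := by
  have h0 : coeff 0 d = c 0 := by simp [hc]
  have hc0 : c 0 ≠ 0 := by
    have := congrArg (coeff 0) h
    rw [coeff_mul] at this
    rintro hz
    simp [h0, hz] at this
  have key := coeff_of_mul_eq_one h l
  rw [reciprocalDeriv, sum_faaDiBrunoIndex, div_mul_eq_mul_div, mul_div_assoc]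
  congr 1
  rw [eq_div_iff (pow_ne_zero _ hc0), mul_comm, ← h0, key, h0]
  refine Finset.sum_congr rfl fun m hm => ?_
  have hml : m ≤ l := by simpa [Nat.lt_succ_iff] using hm
  rw [coeff_pow_sum_C_mul_X_pow, Finset.mul_sum]
  refine Finset.sum_congr rfl fun k hk => ?_
  simp only [Finset.mem_filter, Finset.mem_piAntidiag] at hk
  have hmul : (Nat.multinomial Finset.univ k : ℝ) = m.factorial / ∏ j, ((k j).factorial : ℝ) := by
    rw [eq_div_iff (by positivity), mul_comm]
    have := Nat.multinomial_spec Finset.univ k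
    rw [hk.1.1] at this
    exact_mod_cast this
  have e1 : l - (l - m) = m := by omega
  simp only [Fin.cons_zero, Fin.cons_succ, Fin.prod_univ_succ, hmul, hc, e1, Fin.val_zero,
    Fin.val_succ]
  have e2 : ∏ j : Fin l, (-(c ((j : ℕ) + 1) / (((j : ℕ) + 1).factorial : ℝ))) ^ k j
      = (-1) ^ m * (∏ j : Fin l, c ((j : ℕ) + 1) ^ k j)
        / ∏ j : Fin l, ((((j : ℕ) + 1).factorial : ℝ)) ^ k j := by
    rw [← hk.1.1, ← Finset.prod_pow_eq_pow_sum, ← Finset.prod_mul_distrib, ← Finset.prod_div_distrib]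
    refine Finset.prod_congr rfl fun j _ => ?_
    rw [← mul_pow, ← div_pow]
    ring
  rw [e2, Finset.prod_mul_distrib]
  field_simp

lemma iteratedDeriv_inv_eq_reciprocalDeriv {g : ℝ → ℝ} {a : ℝ} (hg : AnalyticAt ℝ g a)
    (h0 : g a ≠ 0) (l : ℕ) :
    iteratedDeriv l (fun z => (g z)⁻¹) a = reciprocalDeriv (fun j => iteratedDeriv j g a) l := by
  have h : taylorSeries (fun z => (g z)⁻¹) a * taylorSeries g a = 1 := by
    rw [← taylorSeries_mul (hg.fun_inv h0) hg, ← map_one (C (R := ℝ)), ← taylorSeries_const 1 a]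
    refine taylorSeries_congr ?_
    filter_upwards [hg.continuousAt.eventually_ne h0] with z hz
    exact inv_mul_cancel₀ hz
  rw [iteratedDeriv_eq_coeff_taylorSeries]
  exact factorial_mul_coeff_eq_reciprocalDeriv h (fun j => coeff_taylorSeries g a j) l

/-- The Leibniz rule for the derivatives of a power. -/
lemma iteratedDeriv_pow_eq_sum_multinomial {f : ℝ → ℝ} {a : ℝ} (hf : AnalyticAt ℝ f a) (n p : ℕ) :
    iteratedDeriv n (fun z => f z ^ p) a
      = ∑ l ∈ Finset.piAntidiag (Finset.univ : Finset (Fin p)) n,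
          (Nat.multinomial Finset.univ l : ℝ) * ∏ i, iteratedDeriv (l i) f a := by
  have hp : taylorSeries f a ^ p = ∏ _i : Fin p, taylorSeries f a := by simp
  rw [iteratedDeriv_eq_coeff_taylorSeries, taylorSeries_pow hf, hp, coeff_prod, Finset.mul_sum]
  refine Finset.sum_bij' (fun k _ => ⇑k) (fun k _ => Finsupp.equivFunOnFinite.symm k)
    (by simp) (by simp) (by simp) (by simp) fun k hk => ?_
  simp only [Finset.mem_finsuppAntidiag] at hk
  have hm : (n.factorial : ℝ) = (∏ i, ((k i).factorial : ℝ)) * Nat.multinomial Finset.univ k := by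
    have := Nat.multinomial_spec Finset.univ k
    rw [hk.1] at this
    exact_mod_cast this.symm
  simp only [coeff_taylorSeries, Finset.prod_div_distrib, hm]
  have : ∏ i, ((k i).factorial : ℝ) ≠ 0 := by positivity
  field_simp

end FormalSeries

-- The real digamma function: recurrence, monotonicity, series

local notation "γ" => Real.eulerMascheroniConstant

lemma differentiableAt_Gamma_of_pos {x : ℝ} (hx : 0 < x) : DifferentiableAt ℝ Real.Gamma x :=
  Real.differentiableAt_Gamma fun m => by
    have : (0 : ℝ) ≤ m := m.cast_nonneg
    linarith

lemma deriv_Gamma_eq_mul_psi {x : ℝ} (hx : 0 < x) :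
    deriv Real.Gamma x = Real.Gamma x * psi x := by
  have := (Real.Gamma_pos_of_pos hx).ne'
  rw [psi]
  field_simp

lemma psi_add_one {x : ℝ} (hx : 0 < x) : psi (x + 1) = psi x + 1 / x := by
  have h1 : deriv Real.Gamma (x + 1) = Real.Gamma x + x * deriv Real.Gamma x := by
    rw [← deriv_comp_add_const]
    have : (fun y => Real.Gamma (y + 1)) =ᶠ[𝓝 x] fun y => y * Real.Gamma y := by
      filter_upwards [eventually_ne_nhds hx.ne'] with y hy using Real.Gamma_add_one hy
    rw [this.deriv_eq, deriv_fun_mul differentiableAt_fun_id (differentiableAt_Gamma_of_pos hx)]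
    simp
  have := (Real.Gamma_pos_of_pos hx).ne'
  rw [psi, psi, h1, Real.Gamma_add_one hx.ne']
  field_simp
  ring

lemma psi_add_nat {x : ℝ} (hx : 0 < x) (n : ℕ) :
    psi (x + n) = psi x + ∑ k ∈ Finset.range n, 1 / (k + x) := by
  induction n with
  | zero => simp
  | succ n ih =>
    rw [Nat.cast_succ, ← add_assoc, psi_add_one (by positivity), ih, Finset.sum_range_succ,
      add_comm x, add_assoc]

lemma psi_one : psi 1 = -γ := by
  simp [psi, Real.hasDerivAt_Gamma_one.deriv]

lemma psi_one_half : psi (1 / 2) = -γ - 2 * Real.log 2 := by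
  have : Real.sqrt Real.pi ≠ 0 := (Real.sqrt_pos.mpr Real.pi_pos).ne'
  rw [psi, Real.hasDerivAt_Gamma_one_half.deriv, Real.Gamma_one_half_eq]
  field_simp
  ring

/-- `ψ` is the derivative of the convex function `log Γ`. -/
lemma monotoneOn_psi : MonotoneOn psi (Set.Ioi 0) := by
  have hd : ∀ x ∈ Set.Ioi (0 : ℝ), HasDerivAt (Real.log ∘ Real.Gamma) (psi x) x := fun x hx =>
    (differentiableAt_Gamma_of_pos hx).hasDerivAt.log (Real.Gamma_pos_of_pos hx).ne'
  have h := Real.convexOn_log_Gamma.monotoneOn_deriv fun x hx => (hd x hx).differentiableAt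
  exact h.congr fun x hx => (hd x hx).deriv

/-- By monotonicity the shift by `x` costs at most a shift by an integer `M ≥ x`, and the recurrence
bounds that by `M / (n + 1)`. This fixes the additive constant in the series for `ψ`. -/
lemma tendsto_psi_add_nat_sub {x : ℝ} (hx : 0 < x) :
    Tendsto (fun n : ℕ => psi (x + 1 + n) - psi (1 + n)) atTop (𝓝 0) := by
  obtain ⟨M, hM⟩ := exists_nat_ge x
  have hlim : Tendsto (fun n : ℕ => (M : ℝ) * (1 / ((n : ℝ) + 1))) atTop (𝓝 0) := by
    simpa using tendsto_one_div_add_atTop_nhds_zero_nat.const_mul (M : ℝ)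
  refine squeeze_zero (fun n => ?_) (fun n => ?_) hlim
  · have : (0 : ℝ) ≤ n := n.cast_nonneg
    refine sub_nonneg.mpr (monotoneOn_psi ?_ ?_ ?_) <;> simp <;> linarith
  · have hn : (0 : ℝ) ≤ n := n.cast_nonneg
    have h1 : psi (x + 1 + n) ≤ psi ((1 + n : ℝ) + M) :=
      monotoneOn_psi (by simp; linarith) (by simp; linarith) (by linarith)
    rw [psi_add_nat (x := 1 + n) (by positivity)] at h1
    have h2 : ∑ k ∈ Finset.range M, 1 / ((k : ℝ) + (1 + n)) ≤ M * (1 / ((n : ℝ) + 1)) := by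
      refine (Finset.sum_le_card_nsmul _ _ (1 / ((n : ℝ) + 1)) fun k _ => ?_).trans (by simp)
      have : (0 : ℝ) ≤ k := k.cast_nonneg
      exact one_div_le_one_div_of_le (by positivity) (by linarith)
    linarith

lemma hasSum_psi {x : ℝ} (hx : 0 < x) :
    HasSum (fun k : ℕ => 1 / ((k : ℝ) + 1) - 1 / (k + 1 + x)) (psi x + γ + 1 / x) := by
  rw [hasSum_iff_tendsto_nat_of_nonneg]
  · have h := (tendsto_psi_add_nat_sub hx).const_sub (psi (x + 1) + γ)
    rw [psi_add_one hx, sub_zero] at h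
    convert h using 2 with n
    · rw [psi_add_nat (by positivity), psi_add_nat one_pos, psi_one, psi_add_one hx,
        Finset.sum_sub_distrib]
      have : ∀ k : ℕ, (k : ℝ) + 1 + x = k + (x + 1) := fun k => by ring
      simp only [this]
      ring
    · ring
  · intro k
    exact sub_nonneg.mpr (one_div_le_one_div_of_le (by positivity) (by linarith))

/-! ### Digamma as a holomorphic function -/

/-- The digamma function on the right half-plane, as a series. -/
noncomputable def digammaC (z : ℂ) : ℂ :=
  -(γ : ℂ) - 1 / z + ∑' k : ℕ, (1 / ((k : ℂ) + 1) - 1 / (k + 1 + z))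

/-- Working on `Re z > -1/2` instead of `Re z > 0` keeps the imaginary axis inside the domain where
the series without its `1 / z` term is holomorphic; the axis is needed for the boundary values. -/
lemma add_half_le_norm {z : ℂ} (hz : -(1 / 2) < z.re) (k : ℕ) :
    ((k : ℝ) + 1) / 2 ≤ ‖(k : ℂ) + 1 + z‖ := by
  have h := Complex.re_le_norm ((k : ℂ) + 1 + z)
  simp at h
  have : (0 : ℝ) ≤ k := k.cast_nonneg
  linarith

lemma natCast_add_one_add_ne_zero {z : ℂ} (hz : -(1 / 2) < z.re) (k : ℕ) : (k : ℂ) + 1 + z ≠ 0 :=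
  norm_pos_iff.mp (lt_of_lt_of_le (by positivity) (add_half_le_norm hz k))

lemma summable_const_div_sq (C : ℝ) : Summable fun k : ℕ => C / ((k : ℝ) + 1) ^ 2 := by
  have h := ((summable_nat_add_iff 1).mpr
    (Real.summable_one_div_nat_pow.mpr one_lt_two)).mul_left C
  refine h.congr fun k => ?_
  push_cast
  ring

lemma norm_digamma_term_le {z : ℂ} (hz : -(1 / 2) < z.re) (k : ℕ) :
    ‖1 / ((k : ℂ) + 1) - 1 / (k + 1 + z)‖ ≤ (2 * ‖z‖) / ((k : ℝ) + 1) ^ 2 := by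
  have h1 : (k : ℂ) + 1 ≠ 0 := Nat.cast_add_one_ne_zero k
  have h2 := natCast_add_one_add_ne_zero hz k
  have h3 := add_half_le_norm hz k
  have e : 1 / ((k : ℂ) + 1) - 1 / (k + 1 + z) = z / (((k : ℂ) + 1) * (k + 1 + z)) := by
    field_simp
    ring
  have h4 : ‖(k : ℂ) + 1‖ = (k : ℝ) + 1 := by
    rw [← Nat.cast_succ, Complex.norm_natCast, Nat.cast_succ]
  have hk : (0 : ℝ) < (k : ℝ) + 1 := by positivity
  rw [e, norm_div, norm_mul, h4, mul_comm 2, mul_div_assoc, div_eq_mul_inv]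
  refine mul_le_mul_of_nonneg_left ?_ (norm_nonneg z)
  rw [inv_eq_one_div, div_le_div_iff₀ (by positivity) (by positivity)]
  nlinarith

lemma hasSum_digammaC {z : ℂ} (hz : -(1 / 2) < z.re) :
    HasSum (fun k : ℕ => 1 / ((k : ℂ) + 1) - 1 / (k + 1 + z)) (digammaC z + γ + 1 / z) := by
  have h : Summable fun k : ℕ => 1 / ((k : ℂ) + 1) - 1 / (k + 1 + z) :=
    Summable.of_norm_bounded (summable_const_div_sq _) (norm_digamma_term_le hz)
  convert h.hasSum using 1
  rw [digammaC]
  ring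

lemma isOpen_re_gt_ball (R : ℝ) : IsOpen ({z : ℂ | -(1 / 2) < z.re} ∩ Metric.ball 0 R) :=
  (isOpen_lt continuous_const Complex.continuous_re).inter Metric.isOpen_ball

lemma differentiableOn_digamma_term (R : ℝ) (k : ℕ) :
    DifferentiableOn ℂ (fun z => 1 / ((k : ℂ) + 1) - 1 / (k + 1 + z))
      ({z : ℂ | -(1 / 2) < z.re} ∩ Metric.ball 0 R) := by
  intro z hz
  have := natCast_add_one_add_ne_zero hz.1 k
  exact DifferentiableAt.differentiableWithinAt (by fun_prop (disch := assumption))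

lemma norm_digamma_term_le_of_mem (R : ℝ) (k : ℕ) (z : ℂ)
    (hz : z ∈ {z : ℂ | -(1 / 2) < z.re} ∩ Metric.ball 0 R) :
    ‖1 / ((k : ℂ) + 1) - 1 / (k + 1 + z)‖ ≤ (2 * R) / ((k : ℝ) + 1) ^ 2 := by
  refine (norm_digamma_term_le hz.1 k).trans ?_
  have : ‖z‖ < R := by simpa using hz.2
  gcongr

lemma hasDerivAt_digammaC {z : ℂ} (hz : -(1 / 2) < z.re) (h0 : z ≠ 0) :
    ∃ D, HasDerivAt digammaC D z ∧ HasSum (fun k : ℕ => 1 / ((k : ℂ) + z) ^ 2) D := by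
  have hmem : z ∈ {z : ℂ | -(1 / 2) < z.re} ∩ Metric.ball 0 (‖z‖ + 1) := ⟨hz, by simp⟩
  have hd := Complex.differentiableOn_tsum_of_summable_norm
    (summable_const_div_sq (2 * (‖z‖ + 1))) (differentiableOn_digamma_term (‖z‖ + 1))
    (isOpen_re_gt_ball _) (norm_digamma_term_le_of_mem (‖z‖ + 1))
  have hs := Complex.hasSum_deriv_of_summable_norm
    (summable_const_div_sq (2 * (‖z‖ + 1))) (differentiableOn_digamma_term (‖z‖ + 1))
    (isOpen_re_gt_ball _) (norm_digamma_term_le_of_mem (‖z‖ + 1)) hmem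
  have hda := (hd.differentiableAt ((isOpen_re_gt_ball _).mem_nhds hmem)).hasDerivAt
  have hinv : HasDerivAt (fun z : ℂ => -(γ : ℂ) - 1 / z) (1 / z ^ 2) z := by
    have := (hasDerivAt_inv h0).const_sub (-(γ : ℂ))
    simpa using this
  refine ⟨_, hinv.add hda, ?_⟩
  have hterm : ∀ k : ℕ, deriv (fun z : ℂ => 1 / ((k : ℂ) + 1) - 1 / (k + 1 + z)) z
      = 1 / (((k + 1 : ℕ) : ℂ) + z) ^ 2 := by
    intro k
    have hne := natCast_add_one_add_ne_zero hz k
    have h1 : HasDerivAt (fun w : ℂ => (k : ℂ) + 1 + w) 1 z := (hasDerivAt_id z).const_add _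
    have h2 := ((h1.fun_inv hne).const_sub (1 / ((k : ℂ) + 1))).deriv
    simp only [one_div, Nat.cast_succ] at h2 ⊢
    rw [h2, neg_div, neg_neg, one_div]
  simp only [hterm] at hs
  -- The derivative `1 / z ^ 2` of the separated term is the missing `k = 0` term.
  simpa using hs.zero_add (f := fun k : ℕ => 1 / ((k : ℂ) + z) ^ 2)

lemma digammaC_ofReal {x : ℝ} (hx : 0 < x) : digammaC x = psi x := by
  have h1 := (Complex.hasSum_ofReal.mpr (hasSum_psi hx))
  have h2 := hasSum_digammaC (z := x) (by simp; linarith)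
  push_cast at h1
  have := h2.unique h1
  linear_combination this

lemma hasSum_digammaC_sub_div {z w : ℂ} (hz : -(1 / 2) < z.re) (hw : -(1 / 2) < w.re)
    (hz0 : z ≠ 0) (hw0 : w ≠ 0) (hne : z ≠ w) :
    HasSum (fun k : ℕ => 1 / (((k : ℂ) + z) * (k + w))) ((digammaC z - digammaC w) / (z - w)) := by
  have hs := ((hasSum_digammaC hz).sub (hasSum_digammaC hw)).div_const (z - w)
  have hzw : z - w ≠ 0 := sub_ne_zero.mpr hne
  have hs' : HasSum (fun k : ℕ => 1 / ((((k + 1 : ℕ) : ℂ) + z) * (((k + 1 : ℕ) : ℂ) + w)))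
      ((digammaC z + γ + 1 / z - (digammaC w + γ + 1 / w)) / (z - w)) := by
    refine hs.congr_fun fun k => ?_
    have h1 := natCast_add_one_add_ne_zero hz k
    have h2 := natCast_add_one_add_ne_zero hw k
    push_cast
    field_simp
    ring
  have h := hs'.zero_add (f := fun k : ℕ => 1 / (((k : ℂ) + z) * (k + w)))
  convert h using 1
  field_simp
  simp
  field_simp
  ring

lemma hasSum_im_digammaC {z : ℂ} (hz : -(1 / 2) < z.re) :
    HasSum (fun k : ℕ => z.im / Complex.normSq (k + z)) (digammaC z).im := by
  have hs := Complex.hasSum_im (hasSum_digammaC hz)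
  have hs' : HasSum (fun k : ℕ => z.im / Complex.normSq (((k + 1 : ℕ) : ℂ) + z))
      (digammaC z + γ + 1 / z).im := by
    refine hs.congr_fun fun k => ?_
    have e : ((1 : ℂ) / ((k : ℂ) + 1)).im = 0 := by
      rw [← Nat.cast_succ]
      simp
    rw [Complex.sub_im, e, one_div, Complex.inv_im]
    push_cast
    simp [neg_div]
  have h := hs'.zero_add (f := fun k : ℕ => z.im / Complex.normSq (k + z))
  convert h using 1
  simp [Complex.inv_im, neg_div]

/-- Every term of the series for `Im ψ` is `Im z` times a nonnegative number, positive for `k = 0`.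
For real `z` both sides vanish and the factor is arbitrary. -/
lemma exists_pos_im_digammaC {z : ℂ} (hz : -(1 / 2) < z.re) (hz0 : z ≠ 0) :
    ∃ P > 0, (digammaC z).im = z.im * P := by
  have h := hasSum_im_digammaC hz
  by_cases him : z.im = 0
  · refine ⟨1, one_pos, ?_⟩
    simp only [him, zero_div] at h ⊢
    rw [zero_mul]
    exact h.unique hasSum_zero
  · have h' := h.div_const z.im
    refine ⟨(digammaC z).im / z.im, ?_, by field_simp⟩
    have hle := le_hasSum h' 0 fun k _ => by
      have : z.im / Complex.normSq (k + z) / z.im = 1 / Complex.normSq (k + z) := by field_simp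
      rw [this]
      exact one_div_nonneg.mpr (Complex.normSq_nonneg _)
    refine lt_of_lt_of_le ?_ hle
    have h1 : z.im / Complex.normSq (((0 : ℕ) : ℂ) + z) / z.im = 1 / Complex.normSq z := by
      rw [Nat.cast_zero, zero_add]
      field_simp
    rw [h1]
    exact one_div_pos.mpr (Complex.normSq_pos.mpr hz0)

/-! ### Univalence on the right half-plane -/

/-- The hypothesis puts all `p k` in one open half-plane with normal `c`; then every `c / p k` has
positive real part, and so does the sum. -/
lemma hasSum_one_div_ne_zero {p : ℕ → ℂ} {s : ℂ} (hs : HasSum (fun k => 1 / p k) s) (c : ℂ)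
    (hp : ∀ k, 0 < c.re * (p k).re + c.im * (p k).im) : s ≠ 0 := by
  rintro rfl
  have h := Complex.hasSum_re (hs.mul_left c)
  have e : ∀ k, (c * (1 / p k)).re
      = (c.re * (p k).re + c.im * (p k).im) / Complex.normSq (p k) := by
    intro k
    rw [mul_one_div, Complex.div_re]
    ring
  have hpos : ∀ k, 0 < (c * (1 / p k)).re := by
    intro k
    rw [e]
    refine div_pos (hp k) (Complex.normSq_pos.mpr ?_)
    intro h0
    have := hp k
    simp [h0] at this
  have := (hpos 0).trans_le (le_hasSum h 0 fun k _ => (hpos k).le)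
  simp at this

/-- When the imaginary parts have no opposite signs, the arguments of `k + z` and `k + w` add up
without leaving one side of the real axis. Thus the products lie in the upper half-plane, the lower
one, or on the positive axis, and `c` is `I`, `-I` or `1`. -/
lemma hasSum_one_div_mul_ne_zero {z w s : ℂ} (hz : 0 < z.re) (hw : 0 < w.re)
    (him : 0 ≤ z.im * w.im) (hs : HasSum (fun k : ℕ => 1 / (((k : ℂ) + z) * (k + w))) s) :
    s ≠ 0 := by
  have hk : ∀ k : ℕ, (0 : ℝ) ≤ k := fun k => k.cast_nonneg
  have key : ∀ c : ℂ, (∀ k : ℕ, 0 < c.re * ((k + z.re) * (k + w.re) - z.im * w.im)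
      + c.im * ((k + z.re) * w.im + z.im * (k + w.re))) → s ≠ 0 := fun c hc =>
    hasSum_one_div_ne_zero hs c fun k => by simpa using hc k
  rcases lt_trichotomy z.im 0 with h | h | h
  · have hw' : w.im ≤ 0 := by nlinarith
    refine key (-Complex.I) fun k => ?_
    have := hk k
    simp only [Complex.neg_re, Complex.I_re, Complex.neg_im, Complex.I_im]
    nlinarith [mul_nonneg (by linarith : (0 : ℝ) ≤ k + z.re) (neg_nonneg.mpr hw'),
      mul_pos (neg_pos.mpr h) (by linarith : (0 : ℝ) < k + w.re)]
  · rcases lt_trichotomy w.im 0 with h' | h' | h'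
    · refine key (-Complex.I) fun k => ?_
      have := hk k
      simp only [Complex.neg_re, Complex.I_re, Complex.neg_im, Complex.I_im, h]
      nlinarith [mul_pos (by linarith : (0 : ℝ) < k + z.re) (neg_pos.mpr h')]
    · refine key 1 fun k => ?_
      have := hk k
      simp only [Complex.one_re, Complex.one_im, h, h']
      nlinarith [mul_pos (by linarith : (0 : ℝ) < k + z.re) (by linarith : (0 : ℝ) < k + w.re)]
    · refine key Complex.I fun k => ?_
      have := hk k
      simp only [Complex.I_re, Complex.I_im, h]
      nlinarith [mul_pos (by linarith : (0 : ℝ) < k + z.re) h']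
  · have hw' : 0 ≤ w.im := by nlinarith
    refine key Complex.I fun k => ?_
    have := hk k
    simp only [Complex.I_re, Complex.I_im]
    nlinarith [mul_nonneg (by linarith : (0 : ℝ) ≤ k + z.re) hw',
      mul_pos h (by linarith : (0 : ℝ) < k + w.re)]

/-- The open right half-plane. -/
def rightHalfPlane : Set ℂ := {z | 0 < z.re}

lemma isOpen_rightHalfPlane : IsOpen rightHalfPlane :=
  isOpen_lt continuous_const Complex.continuous_re

lemma ne_zero_of_mem_rightHalfPlane {z : ℂ} (hz : z ∈ rightHalfPlane) : z ≠ 0 := by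
  rintro rfl
  simp [rightHalfPlane] at hz

lemma neg_half_lt_re {z : ℂ} (hz : 0 ≤ z.re) : -(1 / 2) < z.re := by linarith

lemma injOn_digammaC : Set.InjOn digammaC rightHalfPlane := by
  intro z hz w hw h
  by_contra hne
  have hz' := neg_half_lt_re (le_of_lt hz)
  have hw' := neg_half_lt_re (le_of_lt hw)
  have hz0 := ne_zero_of_mem_rightHalfPlane hz
  have hw0 := ne_zero_of_mem_rightHalfPlane hw
  obtain ⟨P, hP, hPz⟩ := exists_pos_im_digammaC hz' hz0
  obtain ⟨Q, hQ, hQw⟩ := exists_pos_im_digammaC hw' hw0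
  have him : 0 ≤ z.im * w.im := by
    have h1 : w.im = z.im * P / Q := by
      rw [eq_div_iff hQ.ne', ← hPz, ← hQw, h]
    rw [h1]
    have : z.im * (z.im * P / Q) = z.im ^ 2 * P / Q := by ring
    rw [this]
    positivity
  have := hasSum_one_div_mul_ne_zero hz hw him (hasSum_digammaC_sub_div hz' hw' hz0 hw0 hne)
  simp [h] at this

lemma hasStrictDerivAt_digammaC {z : ℂ} (hz : z ∈ rightHalfPlane) :
    ∃ D, D ≠ 0 ∧ HasStrictDerivAt digammaC D z := by
  have hz' := neg_half_lt_re (le_of_lt hz)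
  obtain ⟨D, hD, hs⟩ := hasDerivAt_digammaC hz' (ne_zero_of_mem_rightHalfPlane hz)
  -- The derivative is the diagonal case `w = z` of the difference quotient.
  refine ⟨D, hasSum_one_div_mul_ne_zero hz hz (mul_self_nonneg _) (by simpa only [sq] using hs), ?_⟩
  have hda : AnalyticAt ℂ digammaC z := by
    refine DifferentiableOn.analyticAt (s := rightHalfPlane) (fun w hw => ?_)
      (isOpen_rightHalfPlane.mem_nhds hz)
    obtain ⟨D', hD', -⟩ := hasDerivAt_digammaC (neg_half_lt_re (le_of_lt hw))
      (ne_zero_of_mem_rightHalfPlane hw)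
    exact hD'.differentiableAt.differentiableWithinAt
  rw [← hD.deriv]
  exact hda.hasStrictDerivAt

lemma isOpen_image_digammaC : IsOpen (digammaC '' rightHalfPlane) := by
  rw [isOpen_iff_mem_nhds]
  rintro _ ⟨z, hz, rfl⟩
  obtain ⟨D, hD0, hD⟩ := hasStrictDerivAt_digammaC hz
  rw [← hD.map_nhds_eq hD0]
  exact image_mem_map (isOpen_rightHalfPlane.mem_nhds hz)

/-! ### Boundary behaviour and the image of the half-plane -/

lemma norm_le_norm_natCast_add {z : ℂ} (hz : 0 ≤ z.re) (k : ℕ) : ‖z‖ ≤ ‖(k : ℂ) + 1 + z‖ := by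
  rw [← sq_le_sq₀ (norm_nonneg _) (norm_nonneg _), Complex.sq_norm, Complex.sq_norm,
    Complex.normSq_apply, Complex.normSq_apply]
  have : (0 : ℝ) ≤ k := k.cast_nonneg
  simp
  nlinarith

lemma natCast_add_one_le_norm {z : ℂ} (hz : 0 ≤ z.re) (k : ℕ) :
    (k : ℝ) + 1 ≤ ‖(k : ℂ) + 1 + z‖ := by
  have h := Complex.re_le_norm ((k : ℂ) + 1 + z)
  simp at h
  linarith

lemma one_div_sub_one_div_norm_le_re (z : ℂ) (k : ℕ) :
    1 / ((k : ℝ) + 1) - 1 / ‖(k : ℂ) + 1 + z‖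
      ≤ (1 / ((k : ℂ) + 1) - 1 / ((k : ℂ) + 1 + z)).re := by
  have h1 : (1 / ((k : ℂ) + 1)).re = 1 / ((k : ℝ) + 1) := by
    rw [← Complex.ofReal_natCast, ← Complex.ofReal_one, ← Complex.ofReal_add, ← Complex.ofReal_div,
      Complex.ofReal_re]
  have h2 := Complex.re_le_norm (1 / ((k : ℂ) + 1 + z))
  rw [norm_div, norm_one] at h2
  rw [Complex.sub_re, h1]
  linarith

lemma re_digamma_term_nonneg {z : ℂ} (hz : 0 ≤ z.re) (k : ℕ) :
    0 ≤ (1 / ((k : ℂ) + 1) - 1 / ((k : ℂ) + 1 + z)).re := by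
  refine le_trans ?_ (one_div_sub_one_div_norm_le_re z k)
  exact sub_nonneg.mpr
    (one_div_le_one_div_of_le (by positivity) (natCast_add_one_le_norm hz k))

/-- `Re ψ(z) → ∞` as `z → ∞` in the closed right half-plane. -/
lemma exists_le_re_digammaC (M : ℝ) :
    ∃ R, ∀ z : ℂ, 0 ≤ z.re → R ≤ ‖z‖ → M ≤ (digammaC z).re := by
  -- The surplus `2` pays for `N / ‖z‖ ≤ 1` and `Re (1 / z) ≤ 1`, both valid once `‖z‖ ≥ N + 1`.
  obtain ⟨N, hN⟩ := (Real.tendsto_sum_range_one_div_nat_succ_atTop.eventually_ge_atTop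
    (M + γ + 2)).exists
  refine ⟨N + 1, fun z hz hR => ?_⟩
  have hz1 : (0 : ℝ) < ‖z‖ := lt_of_lt_of_le (by positivity) hR
  have hs := Complex.hasSum_re (hasSum_digammaC (neg_half_lt_re hz))
  have h1 := sum_le_hasSum (Finset.range N) (fun k _ => re_digamma_term_nonneg hz k) hs
  have h2 : ∑ k ∈ Finset.range N, (1 / ((k : ℝ) + 1) - 1 / ‖z‖)
      ≤ ∑ k ∈ Finset.range N, (1 / ((k : ℂ) + 1) - 1 / ((k : ℂ) + 1 + z)).re := by
    refine Finset.sum_le_sum fun k _ => le_trans ?_ (one_div_sub_one_div_norm_le_re z k)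
    exact sub_le_sub_left (one_div_le_one_div_of_le hz1 (norm_le_norm_natCast_add hz k)) _
  rw [Finset.sum_sub_distrib] at h2
  simp only [Finset.sum_const, Finset.card_range, nsmul_eq_mul] at h2
  have h3 : (N : ℝ) * (1 / ‖z‖) ≤ 1 := by
    rw [mul_one_div, div_le_one hz1]
    linarith
  have h4 : (1 / z).re ≤ 1 := by
    refine (Complex.re_le_norm _).trans ?_
    rw [norm_div, norm_one, div_le_one hz1]
    have : (0 : ℝ) ≤ N := N.cast_nonneg
    linarith
  simp only [Complex.add_re, Complex.ofReal_re] at h1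
  linarith

/-- `ψ(z) → ∞` as `z → 0` in the closed right half-plane. -/
lemma exists_le_norm_of_norm_digammaC_le (M R : ℝ) :
    ∃ ε > 0, ∀ z : ℂ, 0 ≤ z.re → z ≠ 0 → ‖z‖ ≤ R → ‖digammaC z‖ ≤ M → ε ≤ ‖z‖ := by
  set B := ∑' k : ℕ, (2 * R) / ((k : ℝ) + 1) ^ 2
  refine ⟨1 / (|M| + |γ| + |B| + 1), by positivity, fun z hz hz0 hR hM => ?_⟩
  have hs := hasSum_digammaC (neg_half_lt_re hz)
  have h1 : ‖digammaC z + γ + 1 / z‖ ≤ B := by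
    rw [← hs.tsum_eq]
    refine tsum_of_norm_bounded (summable_const_div_sq _).hasSum fun k => ?_
    refine (norm_digamma_term_le (neg_half_lt_re hz) k).trans ?_
    gcongr
  have h2 : ‖1 / z‖ ≤ |M| + |γ| + |B| := by
    have e : 1 / z = (digammaC z + γ + 1 / z) - digammaC z - γ := by ring
    rw [e]
    refine (norm_sub_le _ _).trans ?_
    have h3 := norm_sub_le (digammaC z + γ + 1 / z) (digammaC z)
    have h4 : ‖((γ : ℝ) : ℂ)‖ = |γ| := Complex.norm_real _
    have := le_abs_self M
    have := le_abs_self B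
    linarith
  rw [norm_div, norm_one] at h2
  have hzp : 0 < ‖z‖ := norm_pos_iff.mpr hz0
  rw [div_le_iff₀ hzp] at h2
  rw [div_le_iff₀ (by positivity)]
  linarith

lemma arctan_sub_arctan_le {u v : ℝ} (hv : 0 ≤ v) (huv : v ≤ u) :
    Real.arctan u - Real.arctan v ≤ 1 / (1 + v ^ 2) * (u - v) := by
  refine Convex.image_sub_le_mul_sub_of_deriv_le (convex_Ici v) Real.continuous_arctan.continuousOn
    Real.differentiable_arctan.differentiableOn (fun x hx => ?_) v (by simp) u huv huv
  rw [interior_Ici] at hx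
  rw [Real.deriv_arctan]
  have : v < x := hx
  exact one_div_le_one_div_of_le (by positivity) (by nlinarith)

/-- The sum is a left Riemann sum of the decreasing function `y / (t ^ 2 + y ^ 2)`, whose integral
over `(0, ∞)` is `π / 2`; the comparison is made by telescoping `arctan (k / y)`. -/
lemma pi_div_two_le_of_hasSum {y s : ℝ} (hy : 0 < y)
    (hs : HasSum (fun k : ℕ => y / ((k : ℝ) ^ 2 + y ^ 2)) s) : Real.pi / 2 ≤ s := by
  have h1 : ∀ n : ℕ, Real.arctan ((n : ℝ) / y) ≤ s := by
    intro n
    refine le_trans ?_ (sum_le_hasSum (Finset.range n) (fun k _ => by positivity) hs)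
    have h := Finset.sum_range_sub (fun k : ℕ => Real.arctan ((k : ℝ) / y)) n
    simp only [Nat.cast_zero, zero_div, Real.arctan_zero, sub_zero] at h
    rw [← h]
    refine Finset.sum_le_sum fun k _ => ?_
    refine (arctan_sub_arctan_le (by positivity) (by gcongr; simp)).trans (le_of_eq ?_)
    push_cast
    field_simp
    ring
  have h2 : Tendsto (fun n : ℕ => Real.arctan ((n : ℝ) / y)) atTop (𝓝 (Real.pi / 2)) :=
    (Real.tendsto_arctan_atTop.mono_right nhdsWithin_le_nhds).comp
      (tendsto_natCast_atTop_atTop.atTop_div_const hy)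
  exact le_of_tendsto' h2 h1

lemma pi_div_two_le_abs_im_digammaC {z : ℂ} (hz : z.re = 0) (hz0 : z ≠ 0) :
    Real.pi / 2 ≤ |(digammaC z).im| := by
  have h := hasSum_im_digammaC (neg_half_lt_re hz.ge)
  have hn : ∀ k : ℕ, Complex.normSq (k + z) = (k : ℝ) ^ 2 + z.im ^ 2 := by
    intro k
    rw [Complex.normSq_apply]
    simp [hz]
    ring
  simp only [hn] at h
  have him : z.im ≠ 0 := fun h0 => hz0 (Complex.ext hz h0)
  rcases him.lt_or_gt with hneg | hpos
  · have h' := h.neg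
    refine (pi_div_two_le_of_hasSum (neg_pos.mpr hneg) ?_).trans (neg_le_abs _)
    simpa only [neg_div, neg_sq] using h'
  · exact (pi_div_two_le_of_hasSum hpos h).trans (le_abs_self _)

lemma neg_eulerMascheroni_le_re_digammaC {z : ℂ} (hz : z.re = 0) : -γ ≤ (digammaC z).re := by
  have hs := Complex.hasSum_re (hasSum_digammaC (neg_half_lt_re hz.ge))
  have := hs.nonneg fun k => re_digamma_term_nonneg hz.ge k
  have h1 : (1 / z).re = 0 := by simp [hz]
  simp only [Complex.add_re, Complex.ofReal_re, h1] at this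
  linarith

lemma continuousOn_digammaC {s : Set ℂ} (hs : ∀ z ∈ s, 0 ≤ z.re ∧ z ≠ 0) :
    ContinuousOn digammaC s := fun z hz => by
  obtain ⟨D, hD, -⟩ := hasDerivAt_digammaC (neg_half_lt_re (hs z hz).1) (hs z hz).2
  exact hD.continuousAt.continuousWithinAt

/-- Preimages of points near `w` stay in a compact part of the closed half-plane away from `0`, so
`w` is itself a value there: either at an interior point or on the imaginary axis. -/
lemma closure_image_digammaC_subset :
    closure (digammaC '' rightHalfPlane) ⊆ digammaC '' rightHalfPlane ∪
      {w | -γ ≤ w.re ∧ Real.pi / 2 ≤ |w.im|} := by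
  intro w hw
  obtain ⟨R, hR⟩ := exists_le_re_digammaC (‖w‖ + 1 + 1)
  obtain ⟨ε, hε, hεz⟩ := exists_le_norm_of_norm_digammaC_le (‖w‖ + 1) R
  set K : Set ℂ := ({z | 0 ≤ z.re} ∩ {z | ε ≤ ‖z‖}) ∩ Metric.closedBall 0 R with hK
  have hKc : IsCompact K := by
    rw [hK, Set.inter_comm]
    exact (isCompact_closedBall 0 R).inter_right
      ((isClosed_le continuous_const Complex.continuous_re).inter
        (isClosed_le continuous_const continuous_norm))
  have hKp : ∀ z ∈ K, 0 ≤ z.re ∧ z ≠ 0 := fun z hz =>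
    ⟨hz.1.1, norm_pos_iff.mp (hε.trans_le hz.1.2)⟩
  have hcl : IsClosed (digammaC '' K) := (hKc.image_of_continuousOn (continuousOn_digammaC hKp)).isClosed
  have hwK : w ∈ digammaC '' K := by
    by_contra hn
    have hnb : Metric.ball w 1 ∩ (digammaC '' K)ᶜ ∈ 𝓝 w :=
      inter_mem (Metric.ball_mem_nhds w one_pos) (hcl.isOpen_compl.mem_nhds hn)
    obtain ⟨_, ⟨hb, hnk⟩, z, hz, rfl⟩ := mem_closure_iff_nhds.mp hw _ hnb
    have hzr : 0 ≤ z.re := le_of_lt hz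
    have hz0 := ne_zero_of_mem_rightHalfPlane hz
    have hnorm : ‖digammaC z‖ ≤ ‖w‖ + 1 := by
      have h1 : ‖digammaC z - w‖ < 1 := by rwa [Metric.mem_ball, dist_eq_norm] at hb
      have h2 := norm_add_le (digammaC z - w) w
      rw [sub_add_cancel] at h2
      linarith
    have hzR : ‖z‖ ≤ R := by
      by_contra hlt
      have h1 := hR z hzr (not_le.mp hlt).le
      have h2 := Complex.re_le_norm (digammaC z)
      linarith
    exact hnk ⟨z, ⟨⟨hzr, hεz z hzr hz0 hzR hnorm⟩, by simpa using hzR⟩, rfl⟩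
  obtain ⟨z, hz, rfl⟩ := hwK
  obtain ⟨hzr, hz0⟩ := hKp z hz
  rcases hzr.eq_or_lt with h | h
  · exact Or.inr ⟨neg_eulerMascheroni_le_re_digammaC h.symm,
      pi_div_two_le_abs_im_digammaC h.symm hz0⟩
  · exact Or.inl ⟨z, h, rfl⟩

/-- A connected set that meets the image of the right half-plane under `ψ` is contained in it if it
avoids the region `Re w ≥ -γ`, `|Im w| ≥ π / 2`. -/
lemma subset_image_digammaC {s : Set ℂ} (hs : IsPreconnected s)
    (hne : (s ∩ digammaC '' rightHalfPlane).Nonempty)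
    (hav : ∀ w ∈ s, -γ ≤ w.re → |w.im| < Real.pi / 2) : s ⊆ digammaC '' rightHalfPlane := by
  -- The image is open, and the avoided region makes it relatively closed in `s`.
  refine hs.subset_of_closure_inter_subset isOpen_image_digammaC hne ?_
  rintro w ⟨hw, hws⟩
  rcases closure_image_digammaC_subset hw with h | h
  · exact h
  · exact absurd (hav w hws h.1) (not_lt.mpr h.2)

/-! ### The holomorphic inverse -/

/-- The inverse of the digamma function on the image of the right half-plane. -/
noncomputable def invDigammaC : ℂ → ℂ := Function.invFunOn digammaC rightHalfPlane

lemma invDigammaC_digammaC {z : ℂ} (hz : z ∈ rightHalfPlane) : invDigammaC (digammaC z) = z :=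
  injOn_digammaC.leftInvOn_invFunOn hz

lemma differentiableOn_invDigammaC :
    DifferentiableOn ℂ invDigammaC (digammaC '' rightHalfPlane) := by
  rintro _ ⟨z, hz, rfl⟩
  obtain ⟨D, hD0, hD⟩ := hasStrictDerivAt_digammaC hz
  have hl := (hD.to_localInverse hD0).hasDerivAt
  have hmem : ∀ᶠ w in 𝓝 (digammaC z), hD.localInverse _ _ _ hD0 w ∈ rightHalfPlane := by
    refine hl.continuousAt.eventually_mem (isOpen_rightHalfPlane.mem_nhds ?_)
    have e : hD.localInverse _ _ _ hD0 (digammaC z) = z :=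
      HasStrictFDerivAt.localInverse_apply_image ..
    rwa [e]
  -- Injectivity forces the globally chosen inverse to agree with the local one as long as the
  -- latter stays in the half-plane.
  have heq : invDigammaC =ᶠ[𝓝 (digammaC z)] hD.localInverse _ _ _ hD0 := by
    filter_upwards [hmem, hD.eventually_right_inverse hD0] with w hw hinv
    rw [← invDigammaC_digammaC hw, hinv]
  exact (hl.congr_of_eventuallyEq heq).differentiableAt.differentiableWithinAt

/-! ### Derivatives of the real digamma function and Hurwitz zeta values -/

lemma ofReal_mem_rightHalfPlane {x : ℝ} (hx : 0 < x) : (x : ℂ) ∈ rightHalfPlane := by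
  simpa [rightHalfPlane] using hx

lemma psi_eventuallyEq_re_digammaC {x : ℝ} (hx : 0 < x) :
    psi =ᶠ[𝓝 x] fun y : ℝ => (digammaC y).re := by
  filter_upwards [lt_mem_nhds hx] with y hy
  rw [digammaC_ofReal hy, Complex.ofReal_re]

lemma analyticAt_digammaC {z : ℂ} (hz : z ∈ rightHalfPlane) : AnalyticAt ℂ digammaC z := by
  refine DifferentiableOn.analyticAt (s := rightHalfPlane) (fun w hw => ?_)
    (isOpen_rightHalfPlane.mem_nhds hz)
  obtain ⟨D, -, hD⟩ := hasStrictDerivAt_digammaC hw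
  exact hD.hasDerivAt.differentiableAt.differentiableWithinAt

lemma analyticAt_psi {x : ℝ} (hx : 0 < x) : AnalyticAt ℝ psi x :=
  (analyticAt_digammaC (ofReal_mem_rightHalfPlane hx)).re_ofReal.congr
    (psi_eventuallyEq_re_digammaC hx).symm

lemma summable_one_div_natCast_add_pow {x : ℝ} (hx : 0 < x) {u : ℕ} (hu : 2 ≤ u) :
    Summable fun k : ℕ => 1 / ((k : ℝ) + x) ^ u := by
  have h := (Real.summable_one_div_nat_add_rpow x u).mpr (by exact_mod_cast hu)
  refine h.congr fun k => ?_
  have : (0 : ℝ) < k + x := by positivity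
  rw [abs_of_pos this, Real.rpow_natCast]

lemma hasDerivAt_psi {x : ℝ} (hx : 0 < x) : HasDerivAt psi (hurwitz 2 x) x := by
  obtain ⟨D, hD, hs⟩ := hasDerivAt_digammaC (z := x) (by simp; linarith)
    (by exact_mod_cast hx.ne')
  have h1 := Complex.hasSum_re hs
  have h2 : D.re = hurwitz 2 x := by
    rw [← h1.tsum_eq, hurwitz]
    refine tsum_congr fun k => ?_
    rw [← Complex.ofReal_natCast, ← Complex.ofReal_add, ← Complex.ofReal_pow, ← Complex.ofReal_one,
      ← Complex.ofReal_div, Complex.ofReal_re]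
  rw [← h2]
  exact hD.real_of_complex.congr_of_eventuallyEq (psi_eventuallyEq_re_digammaC hx)

lemma hurwitz_pos {x : ℝ} (hx : 0 < x) {u : ℕ} (hu : 2 ≤ u) : 0 < hurwitz u x :=
  (summable_one_div_natCast_add_pow hx hu).tsum_pos (fun k => by positivity) 0 (by positivity)

lemma hasDerivAt_hurwitz {x : ℝ} (hx : 0 < x) {u : ℕ} (hu : 2 ≤ u) :
    HasDerivAt (hurwitz u) (-u * hurwitz (u + 1) x) x := by
  -- On `(x / 2, ∞)` the differentiated terms are dominated by their values at `x / 2`.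
  have hx2 : 0 < x / 2 := by positivity
  have hterm : ∀ (k : ℕ) (y : ℝ), y ∈ Set.Ioi (x / 2) →
      HasDerivAt (fun y : ℝ => 1 / ((k : ℝ) + y) ^ u) (-u * (1 / ((k : ℝ) + y) ^ (u + 1))) y := by
    intro k y hy
    have hy' : x / 2 < y := hy
    have hpos : 0 < (k : ℝ) + y := by linarith [(k.cast_nonneg : (0 : ℝ) ≤ k)]
    have h1 : HasDerivAt (fun y : ℝ => (k : ℝ) + y) 1 y := (hasDerivAt_id y).const_add _
    have h2 := (h1.fun_pow u).fun_inv (pow_ne_zero u hpos.ne')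
    simp only [one_div]
    refine h2.congr_deriv ?_
    obtain ⟨v, rfl⟩ : ∃ v, u = v + 1 := ⟨u - 1, by omega⟩
    rw [Nat.add_sub_cancel]
    field_simp
    ring
  have hsum := (summable_one_div_natCast_add_pow hx2 (by omega : 2 ≤ u + 1)).mul_left (u : ℝ)
  have h := hasDerivAt_tsum_of_isPreconnected hsum isOpen_Ioi (convex_Ioi (x / 2)).isPreconnected
    hterm (fun k y hy => ?_) (y₀ := x) (show x / 2 < x by linarith)
    (summable_one_div_natCast_add_pow hx hu) (show x / 2 < x by linarith)
  · rwa [tsum_mul_left] at h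
  · have hy' : x / 2 < y := hy
    have hpos : 0 < (k : ℝ) + x / 2 := by positivity
    have hpos' : 0 < (k : ℝ) + y := by linarith
    rw [norm_mul, norm_neg, Real.norm_natCast, Real.norm_of_nonneg (by positivity)]
    gcongr

lemma iteratedDeriv_psi (j : ℕ) {x : ℝ} (hx : 0 < x) :
    iteratedDeriv (j + 1) psi x = (-1) ^ (j + 2) * ((j + 1).factorial : ℝ) * hurwitz (j + 2) x := by
  induction j generalizing x with
  | zero => simp [iteratedDeriv_one, (hasDerivAt_psi hx).deriv]
  | succ j ih =>
    have heq : iteratedDeriv (j + 1) psi =ᶠ[𝓝 x]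
        fun y => (-1) ^ (j + 2) * ((j + 1).factorial : ℝ) * hurwitz (j + 2) y := by
      filter_upwards [lt_mem_nhds hx] with y hy using ih hy
    rw [iteratedDeriv_succ, heq.deriv_eq,
      ((hasDerivAt_hurwitz hx (by omega : 2 ≤ j + 2)).const_mul _).deriv, Nat.factorial_succ (j + 1)]
    push_cast
    ring

lemma psiData_eq_zetaData {a : ℝ} (ha : 0 < a) : psiData a = zetaData a := by
  ext j
  rw [psiData, zetaData, iteratedDeriv_psi j ha, Nat.factorial_succ]
  push_cast
  field_simp
  ring

lemma strictMonoOn_psi : StrictMonoOn psi (Set.Ioi 0) :=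
  strictMonoOn_of_deriv_pos (convex_Ioi 0)
    (fun _ hx => (hasDerivAt_psi hx).continuousAt.continuousWithinAt) fun x hx => by
      rw [interior_Ioi] at hx
      rw [(hasDerivAt_psi hx).deriv]
      exact hurwitz_pos hx le_rfl

lemma exists_psi_eq (w : ℝ) : ∃ x, 0 < x ∧ psi x = w := by
  have hlow : ∃ x, 0 < x ∧ psi x ≤ w := by
    -- For `y ≤ 1`, `ψ(y) = ψ(y + 1) - 1 / y ≤ ψ(2) - 1 / y`, so `1 / y` only has to exceed `|ψ(2)|
    -- + |w|`.
    refine ⟨1 / (1 + |psi 2| + |w|), by positivity, ?_⟩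
    set y := 1 / (1 + |psi 2| + |w|) with hy
    have hy0 : 0 < y := by positivity
    have hy1 : y ≤ 1 := by
      rw [hy, div_le_one (by positivity)]
      linarith [abs_nonneg (psi 2), abs_nonneg w]
    have h1 := psi_add_one hy0
    have h2 : psi (y + 1) ≤ psi 2 := monotoneOn_psi (by simp; linarith) (by simp) (by linarith)
    have h3 : 1 / y = 1 + |psi 2| + |w| := by rw [hy, one_div_one_div]
    linarith [le_abs_self (psi 2), neg_abs_le w]
  have hhigh : ∃ x, 0 < x ∧ w ≤ psi x := by
    obtain ⟨N, hN⟩ := (Real.tendsto_sum_range_one_div_nat_succ_atTop.eventually_ge_atTop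
      (w + γ)).exists
    refine ⟨1 + N, by positivity, ?_⟩
    rw [psi_add_nat one_pos, psi_one]
    linarith
  obtain ⟨x, hx, hxw⟩ := hlow
  obtain ⟨y, hy, hyw⟩ := hhigh
  obtain ⟨z, hz, hzw⟩ := isPreconnected_Ioi.intermediate_value (a := x) (b := y) hx hy
    (fun t ht => (hasDerivAt_psi ht).continuousAt.continuousWithinAt) ⟨hxw, hyw⟩
  exact ⟨z, hz, hzw⟩

/-! ### The real inverse and the Lagrange coefficients -/

/-- The inverse of the digamma function `ψ : (0, ∞) → ℝ`. -/
noncomputable def invPsi (w : ℝ) : ℝ := (invDigammaC w).re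

lemma invPsi_psi {x : ℝ} (hx : 0 < x) : invPsi (psi x) = x := by
  rw [invPsi, ← digammaC_ofReal hx, invDigammaC_digammaC (ofReal_mem_rightHalfPlane hx),
    Complex.ofReal_re]

lemma analyticAt_invDigammaC (w : ℝ) : AnalyticAt ℂ invDigammaC w := by
  obtain ⟨x, hx, rfl⟩ := exists_psi_eq w
  refine differentiableOn_invDigammaC.analyticAt (isOpen_image_digammaC.mem_nhds ?_)
  exact ⟨x, ofReal_mem_rightHalfPlane hx, digammaC_ofReal hx⟩

lemma analyticAt_invPsi (w : ℝ) : AnalyticAt ℝ invPsi w :=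
  (analyticAt_invDigammaC w).re_ofReal

/-- Lets the complex Taylor coefficients of the inverse be read as the real Lagrange coefficients.
-/
lemma iteratedDeriv_re_ofReal (n : ℕ) {f : ℂ → ℂ} {x : ℝ} (hf : AnalyticAt ℂ f x) :
    iteratedDeriv n (fun y : ℝ => (f y).re) x = (iteratedDeriv n f x).re := by
  induction n generalizing f with
  | zero => simp
  | succ n ih =>
    rw [iteratedDeriv_succ', iteratedDeriv_succ', ← ih hf.deriv]
    refine Filter.EventuallyEq.iteratedDeriv_eq n ?_
    have : ∀ᶠ y : ℝ in 𝓝 x, AnalyticAt ℂ f (y : ℂ) :=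
      Complex.continuous_ofReal.continuousAt.eventually hf.eventually_analyticAt
    filter_upwards [this] with y hy
    exact hy.differentiableAt.hasDerivAt.real_of_complex.deriv

lemma lagrangeL_eq_inv_dslope (a : ℝ) : lagrangeL a = fun z => (dslope psi a z)⁻¹ := by
  ext z
  rcases eq_or_ne z a with rfl | h
  · simp [lagrangeL]
  · rw [dslope_of_ne _ h, lagrangeL, Function.update_of_ne h, slope_def_field, inv_div]

lemma dslope_psi_ne_zero {a : ℝ} (ha : 0 < a) : dslope psi a a ≠ 0 := by
  rw [dslope_same, (hasDerivAt_psi ha).deriv]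
  exact (hurwitz_pos ha le_rfl).ne'

lemma analyticAt_lagrangeL {a : ℝ} (ha : 0 < a) : AnalyticAt ℝ (lagrangeL a) a := by
  rw [lagrangeL_eq_inv_dslope]
  exact (analyticAt_dslope (analyticAt_psi ha)).fun_inv (dslope_psi_ne_zero ha)

lemma iteratedDeriv_lagrangeL {a : ℝ} (ha : 0 < a) (l : ℕ) :
    iteratedDeriv l (lagrangeL a) a = reciprocalDeriv (psiData a) l := by
  have h : psiData a = fun j => iteratedDeriv j (dslope psi a) a := by
    ext j
    rw [iteratedDeriv_dslope (analyticAt_psi ha), psiData]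
  rw [h, lagrangeL_eq_inv_dslope]
  exact iteratedDeriv_inv_eq_reciprocalDeriv (analyticAt_dslope (analyticAt_psi ha))
    (dslope_psi_ne_zero ha) l

lemma lagrangeCoeff_eq_sum {a : ℝ} (ha : 0 < a) (n : ℕ) : lagrangeCoeff a n =
    ∑ l ∈ Finset.piAntidiag (Finset.univ : Finset (Fin (n + 1))) n,
      (Nat.multinomial Finset.univ l : ℝ) * ∏ i, iteratedDeriv (l i) (lagrangeL a) a :=
  iteratedDeriv_pow_eq_sum_multinomial (analyticAt_lagrangeL ha) n (n + 1)

lemma lagrangeCoeff_eq_doubleFaaDiBruno {a : ℝ} (ha : 0 < a) (n : ℕ) :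
    lagrangeCoeff a n = doubleFaaDiBruno (psiData a) n := by
  simp only [lagrangeCoeff_eq_sum ha, iteratedDeriv_lagrangeL ha, doubleFaaDiBruno]

lemma iteratedDeriv_invPsi {a : ℝ} (ha : 0 < a) (n : ℕ) :
    iteratedDeriv (n + 1) invPsi (psi a) = lagrangeCoeff a n := by
  rw [lagrangeCoeff, lagrangeL_eq_inv_dslope]
  refine iteratedDeriv_leftInverse (analyticAt_psi ha) (analyticAt_invPsi _) ?_ ?_ n
  · simpa using dslope_psi_ne_zero ha
  · filter_upwards [lt_mem_nhds ha] with z hz using invPsi_psi hz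

/-! ### Convergence on a disc in the image -/

lemma hasSum_seriesTerm_of_ball_subset {a R : ℝ} (ha : 0 < a) (hR : |psi a| < R)
    (hav : ∀ w ∈ Metric.ball (psi a : ℂ) R, -γ ≤ w.re → |w.im| < Real.pi / 2) :
    HasSum (seriesTerm a (lagrangeCoeff a)) (invPsi 0 - a) := by
  have hR0 : 0 < R := (abs_nonneg _).trans_lt hR
  have hsub := subset_image_digammaC (convex_ball _ _).isPreconnected
    ⟨(psi a : ℂ), Metric.mem_ball_self hR0, a, ofReal_mem_rightHalfPlane ha, digammaC_ofReal ha⟩ hav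
  have h := Complex.hasSum_taylorSeries_on_ball (z := 0) (differentiableOn_invDigammaC.mono hsub)
    (by simpa [Complex.dist_eq] using hR)
  have h1 := (hasSum_nat_add_iff' 1).mpr (Complex.hasSum_re h)
  have e1 : ∀ n : ℕ, ((((n + 1).factorial : ℂ))⁻¹ • (0 - (psi a : ℂ)) ^ (n + 1) •
      iteratedDeriv (n + 1) invDigammaC (psi a)).re = seriesTerm a (lagrangeCoeff a) n := by
    intro n
    have e : ((((n + 1).factorial : ℂ))⁻¹ • (0 - (psi a : ℂ)) ^ (n + 1) •
        iteratedDeriv (n + 1) invDigammaC (psi a))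
        = (((-psi a) ^ (n + 1) / ((n + 1).factorial : ℝ) : ℝ) : ℂ) *
          iteratedDeriv (n + 1) invDigammaC (psi a) := by
      simp only [smul_eq_mul]
      push_cast
      rw [zero_sub]
      ring
    rw [e, Complex.re_ofReal_mul, ← iteratedDeriv_re_ofReal _ (analyticAt_invDigammaC _), seriesTerm,
      ← iteratedDeriv_invPsi ha]
    rfl
  have e2 : invDigammaC (psi a) = a := by
    rw [← digammaC_ofReal ha, invDigammaC_digammaC (ofReal_mem_rightHalfPlane ha)]
  simp only [e1] at h1
  simpa [e2, invPsi] using h1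

lemma hasSum_seriesTerm {a : ℝ} (h1 : 1 / 2 ≤ a) (h2 : a ≤ 5 / 2) :
    HasSum (seriesTerm a (lagrangeCoeff a)) (invPsi 0 - a) := by
  have ha : 0 < a := by linarith
  have hγ1 := Real.one_half_lt_eulerMascheroniConstant
  have hγ2 := Real.eulerMascheroniConstant_lt_two_thirds
  have hl1 := Real.log_two_gt_d9
  have hl2 := Real.log_two_lt_d9
  have hpi := Real.pi_gt_d2
  have hlow : -γ - 2 * Real.log 2 ≤ psi a := by
    rw [← psi_one_half]
    exact monotoneOn_psi (by simp) ha h1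
  rcases le_total 1 a with h | h
  · have hlow' : -γ ≤ psi a := by
      rw [← psi_one]
      exact monotoneOn_psi (by simp) ha h
    have hhigh : psi a ≤ psi (1 / 2 + (2 : ℕ)) :=
      monotoneOn_psi ha (by norm_num) (by norm_num; exact h2)
    rw [psi_add_nat (by norm_num), psi_one_half] at hhigh
    norm_num [Finset.sum_range_succ] at hhigh
    -- For `a ≥ 1` the disc of radius `π / 2` stays in the strip `|Im w| < π / 2`, and `-γ ≤ ψ(a) ≤
    -- ψ(5/2) = 8/3 - γ - 2 log 2` puts `0` in it.
    refine hasSum_seriesTerm_of_ball_subset ha (R := Real.pi / 2) ?_ fun w hw _ => ?_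
    · rw [abs_lt]
      constructor <;> linarith
    · rw [Metric.mem_ball, Complex.dist_eq] at hw
      have := Complex.abs_im_le_norm (w - psi a)
      simp only [Complex.sub_im, Complex.ofReal_im, sub_zero] at this
      linarith
  · have hhigh : psi a ≤ -γ := by
      rw [← psi_one]
      exact monotoneOn_psi ha (by simp) h
    -- For `a ≤ 1` the centre is left of `-γ`, so the disc may reach the corners `-γ ± iπ / 2` of
    -- the avoided region. It contains `0` because `-2 γ ψ(a) < γ ^ 2 + π ^ 2 / 4`, using `ψ(a) ≥
    -- ψ(1/2)`.
    refine hasSum_seriesTerm_of_ball_subset ha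
      (R := Real.sqrt ((psi a + γ) ^ 2 + (Real.pi / 2) ^ 2)) ?_ fun w hw hre => ?_
    · refine Real.lt_sqrt_of_sq_lt ?_
      rw [sq_abs]
      nlinarith
    · rw [Metric.mem_ball, Complex.dist_eq, Real.lt_sqrt (norm_nonneg _), Complex.sq_norm,
        Complex.normSq_apply] at hw
      simp only [Complex.sub_im, Complex.ofReal_im, sub_zero, Complex.sub_re,
        Complex.ofReal_re] at hw
      refine abs_lt_of_sq_lt_sq ?_ (by positivity)
      nlinarith

/-! ### Abel summation for arbitrary `a` -/

/-- Along the segment from `ψ(a)` to `0` the inverse becomes a function `Q` of `r`, with the series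
as its Taylor series at `r = 1`. Convergence bounds the coefficients, so the radius is at least `1`;
analyticity of `Q` on `ℝ` makes the sum equal `Q` on `(-1, 1)`, and Abel's limit theorem passes to
`r = 1`. -/
lemma eq_of_tendsto_seriesTerm {a s : ℝ} (ha : 0 < a)
    (h : Tendsto (fun N : ℕ => ∑ n ∈ Finset.range N, seriesTerm a (lagrangeCoeff a) n)
      atTop (𝓝 s)) : invPsi 0 = a + s := by
  set Q : ℝ → ℝ := fun r => invPsi (psi a + (-psi a) * r) with hQ
  have hQa : ∀ r, AnalyticAt ℝ Q r := fun r =>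
    AnalyticAt.fun_comp (f := fun r => psi a + (-psi a) * r) (g := invPsi) (analyticAt_invPsi _)
      (by fun_prop)
  have hQd : ∀ n, iteratedDeriv n Q 0 = (-psi a) ^ n * iteratedDeriv n invPsi (psi a) := by
    intro n
    have hc : ContDiff ℝ n fun w => invPsi (psi a + w) :=
      contDiff_iff_contDiffAt.mpr fun w => (AnalyticAt.fun_comp (f := fun w => psi a + w)
        (g := invPsi) (analyticAt_invPsi _) (by fun_prop)).contDiffAt
    have h1 := congrFun (iteratedDeriv_comp_const_mul hc (-psi a)) 0
    rw [hQ, h1]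
    simp [iteratedDeriv_comp_const_add]
  set q : ℕ → ℝ := fun n => iteratedDeriv n Q 0 / n.factorial with hq
  have hq0 : q 0 = a := by simp [hq, hQ, invPsi_psi ha]
  have hq1 : ∀ n, q (n + 1) = seriesTerm a (lagrangeCoeff a) n := by
    intro n
    simp only [hq, hQd, iteratedDeriv_invPsi ha, seriesTerm]
    ring
  have hlim : Tendsto (fun N => ∑ n ∈ Finset.range N, q n) atTop (𝓝 (a + s)) := by
    rw [← tendsto_add_atTop_iff_nat 1]
    simp only [Finset.sum_range_succ', hq0, hq1]
    rw [add_comm]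
    exact h.add_const a
  have hbdd : ∃ C, ∀ n, |q n| ≤ C := by
    have h1 : Tendsto q atTop (𝓝 0) := by
      have := (hlim.comp (tendsto_add_atTop_nat 1)).sub hlim
      simpa [Function.comp_def, Finset.sum_range_succ] using this
    obtain ⟨C, hC⟩ := h1.abs.bddAbove_range
    exact ⟨C, fun n => hC ⟨n, rfl⟩⟩
  obtain ⟨C, hC⟩ := hbdd
  have hser := AnalyticOn.hasFPowerSeriesOnSubball (f := Q) (x := 0) (r := 1) one_pos
    (fun r _ => (hQa r).analyticWithinAt) (by
      refine FormalMultilinearSeries.le_radius_of_bound (r := 1) _ C fun n => ?_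
      simpa [FormalMultilinearSeries.ofScalars_norm, hq, abs_div] using hC n)
  have hsum : ∀ r ∈ Set.Ioo (-1 : ℝ) 1, ∑' n, q n * r ^ n = Q r := by
    intro r hr
    have hr' : r ∈ Metric.eball (0 : ℝ) 1 := by
      have : ‖r‖ < 1 := abs_lt.mpr hr
      simpa [← enorm_eq_nnnorm, ← ofReal_norm] using this
    have := (hser.hasSum hr').tsum_eq
    simpa [FormalMultilinearSeries.ofScalars_apply_eq, mul_comm] using this
  have hA := Real.tendsto_tsum_powerSeries_nhdsWithin_lt hlim
  have hB : Tendsto (fun r => ∑' n, q n * r ^ n) (𝓝[<] 1) (𝓝 (Q 1)) := by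
    refine Tendsto.congr' ?_ ((hQa 1).continuousAt.mono_left nhdsWithin_le_nhds)
    filter_upwards [Ioo_mem_nhdsLT (show (-1 : ℝ) < 1 by norm_num)] with r hr
    exact (hsum r hr).symm
  have := tendsto_nhds_unique hB hA
  rw [← this]
  simp [hQ]

/-! ### The minimum of `Γ` -/

lemma psi_eq_zero_iff {x : ℝ} (hx : 0 < x) : psi x = 0 ↔ x = invPsi 0 := by
  obtain ⟨y, hy, hy0⟩ := exists_psi_eq 0
  rw [← hy0, invPsi_psi hy, strictMonoOn_psi.injOn.eq_iff hx hy]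

lemma invPsi_pos (w : ℝ) : 0 < invPsi w := by
  obtain ⟨y, hy, rfl⟩ := exists_psi_eq w
  rwa [invPsi_psi hy]

lemma Gamma_invPsi_zero_lt {x : ℝ} (hx : 0 < x) (hne : x ≠ invPsi 0) :
    Real.Gamma (invPsi 0) < Real.Gamma x := by
  have hm := invPsi_pos 0
  have h0 : psi (invPsi 0) = 0 := (psi_eq_zero_iff hm).mpr rfl
  rcases hne.lt_or_gt with h | h
  · refine strictAntiOn_of_deriv_neg (convex_Icc x (invPsi 0)) (fun y hy => ?_) (fun y hy => ?_)
      (Set.left_mem_Icc.mpr h.le) (Set.right_mem_Icc.mpr h.le) h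
    · exact (differentiableAt_Gamma_of_pos (hx.trans_le hy.1)).continuousAt.continuousWithinAt
    · rw [interior_Icc] at hy
      have hy0 := hx.trans hy.1
      rw [deriv_Gamma_eq_mul_psi hy0]
      have := strictMonoOn_psi hy0 hm hy.2
      exact mul_neg_of_pos_of_neg (Real.Gamma_pos_of_pos hy0) (by linarith)
  · refine strictMonoOn_of_deriv_pos (convex_Icc (invPsi 0) x) (fun y hy => ?_) (fun y hy => ?_)
      (Set.left_mem_Icc.mpr h.le) (Set.right_mem_Icc.mpr h.le) h
    · exact (differentiableAt_Gamma_of_pos (hm.trans_le hy.1)).continuousAt.continuousWithinAt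
    · rw [interior_Icc] at hy
      have hy0 := hm.trans hy.1
      rw [deriv_Gamma_eq_mul_psi hy0]
      have := strictMonoOn_psi hm hy0 hy.1
      exact mul_pos (Real.Gamma_pos_of_pos hy0) (by linarith)

end GammaMin

theorem mainTheorem1 :
    ∃ zm : ℝ, 0 < zm ∧
      -- `zm` is the unique minimum point of `Γ` on the positive half-line
      (∀ x : ℝ, 0 < x → x ≠ zm → Real.Gamma zm < Real.Gamma x) ∧
      -- and the unique positive zero of the digamma function
      (∀ x : ℝ, 0 < x → (GammaMin.psi x = 0 ↔ x = zm)) ∧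
      ∀ a : ℝ, 0 < a →
        -- the functions that are differentiated are analytic at `a`
        AnalyticAt ℝ GammaMin.psi a ∧
        AnalyticAt ℝ (GammaMin.lagrangeL a) a ∧
        -- derivatives of digamma as Hurwitz zeta values
        (∀ j : ℕ, 1 ≤ j →
          Summable (fun k : ℕ => 1 / ((k : ℝ) + a) ^ (j + 1)) ∧
          iteratedDeriv j GammaMin.psi a =
            (-1 : ℝ) ^ (j + 1) * (j.factorial : ℝ) * GammaMin.hurwitz (j + 1) a) ∧
        -- first application of the Faà di Bruno formula
        (∀ n : ℕ, GammaMin.lagrangeCoeff a n =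
          ∑ l ∈ Finset.piAntidiag (Finset.univ : Finset (Fin (n + 1))) n,
            (Nat.multinomial Finset.univ l : ℝ) *
              ∏ i, iteratedDeriv (l i) (GammaMin.lagrangeL a) a) ∧
        -- second application of the Faà di Bruno formula
        (∀ l : ℕ, iteratedDeriv l (GammaMin.lagrangeL a) a =
          GammaMin.reciprocalDeriv (GammaMin.psiData a) l) ∧
        -- the resulting explicit coefficients, and their Hurwitz zeta form
        (∀ n : ℕ, GammaMin.lagrangeCoeff a n =
          GammaMin.doubleFaaDiBruno (GammaMin.psiData a) n) ∧
        (∀ n : ℕ, GammaMin.lagrangeCoeff a n =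
          GammaMin.doubleFaaDiBruno (GammaMin.zetaData a) n) ∧
        -- convergence of the three forms of the series to `zm`, for `a` in `[1/2, 5/2]`
        (1 / 2 ≤ a → a ≤ 5 / 2 →
          HasSum (GammaMin.seriesTerm a (GammaMin.lagrangeCoeff a)) (zm - a) ∧
          HasSum (GammaMin.seriesTerm a (GammaMin.doubleFaaDiBruno (GammaMin.psiData a)))
            (zm - a) ∧
          HasSum (GammaMin.seriesTerm a (GammaMin.doubleFaaDiBruno (GammaMin.zetaData a)))
            (zm - a)) ∧
        -- for every `a > 0`: whenever the series converges (even conditionally),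
        -- `a` plus its sum is `zm`
        (∀ s : ℝ,
          Tendsto (fun N : ℕ => ∑ n ∈ Finset.range N,
            GammaMin.seriesTerm a (GammaMin.doubleFaaDiBruno (GammaMin.zetaData a)) n)
            atTop (𝓝 s) →
          zm = a + s) := by
  refine ⟨GammaMin.invPsi 0, GammaMin.invPsi_pos 0, fun x hx => GammaMin.Gamma_invPsi_zero_lt hx,
    fun x hx => GammaMin.psi_eq_zero_iff hx, fun a ha => ?_⟩
  -- The coefficient sequences are equal as functions, so the three series reduce to one.
  have hpsi : GammaMin.doubleFaaDiBruno (GammaMin.psiData a) = GammaMin.lagrangeCoeff a :=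
    (funext (GammaMin.lagrangeCoeff_eq_doubleFaaDiBruno ha)).symm
  have hzeta : GammaMin.doubleFaaDiBruno (GammaMin.zetaData a) = GammaMin.lagrangeCoeff a := by
    rw [← GammaMin.psiData_eq_zetaData ha, hpsi]
  rw [hpsi, hzeta]
  refine ⟨GammaMin.analyticAt_psi ha, GammaMin.analyticAt_lagrangeL ha, fun j hj => ?_,
    GammaMin.lagrangeCoeff_eq_sum ha, GammaMin.iteratedDeriv_lagrangeL ha, fun _ => rfl,
    fun _ => rfl, fun h1 h2 => ?_, fun s => GammaMin.eq_of_tendsto_seriesTerm ha⟩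
  · obtain ⟨i, rfl⟩ : ∃ i, j = i + 1 := ⟨j - 1, by omega⟩
    exact ⟨GammaMin.summable_one_div_natCast_add_pow ha (by omega), GammaMin.iteratedDeriv_psi i ha⟩
  · exact ⟨GammaMin.hasSum_seriesTerm h1 h2, GammaMin.hasSum_seriesTerm h1 h2,
      GammaMin.hasSum_seriesTerm h1 h2⟩
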